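/- Let $0\le q<1$ and $\square(q)=\sum_{n=-\infty}^{\infty}q^{n^2}$ (with $0^0=1$). Write $\sum_{k\ge 1}'c_k=\lim_{t\to1^-}\sum_{k=1}^\infty t^kc_k$ for the Abel mean of a series. For real polynomials $f$ put $$\nu_0(f)=2\sum_{k\ge1}{}'\;\frac{1-(-q)^k}{1+(-q)^k}\,(-1)^{k+1}\,k\,f(k^2),\qquad \nu_1(f)=2\sum_{k\ge1}{}'\;\frac{1+(-q)^k}{1-(-q)^k}\,(-1)^{k}\,k^3f(k^2).$$ For every real polynomial $f$ the power series in these Abel means converge for $0<t<1$ and have finite limits as $t\to1^-$, so that $\nu_0$ and $\nu_1$ are well defined. For $\varepsilon=0,1$ there is exactly one sequence $(p_k^{(\varepsilon)})_{k\ge0}$ of real polynomials such that $p^{(\varepsilon)}_k$ is monic of degree $k$ for all $k$ and $\nu_\varepsilon(p_j^{(\varepsilon)}p_k^{(\varepsilon)})=0$ for $j\ne k$. Write $\|p_k^{(\varepsilon)}\|^2=\nu_\varepsilon\big((p_k^{(\varepsilon)})^2\big)$. Then for every integer $m\ge0$ (empty products being $1$) $$\square(q)^{4m^2}=\frac{2^{m(2m-1)}}{\prod_{i=1}^{2m-1}i!}\prod_{i=1}^m\|p_{i-1}^{(0)}\|^2,\qquad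 \square(q)^{4m(m+1)}=\frac{2^{m(2m+1)}}{\prod_{i=1}^{2m}i!}\prod_{i=1}^m\|p_{i-1}^{(1)}\|^2.$$ Equivalently, for every integer $k\ge0$, $$\|p_k^{(0)}\|^2=\frac{(2k+1)!\,(2k)!}{2^{4k+1}}\,\square(q)^{8k+4},\qquad \|p_k^{(1)}\|^2=\frac{(2k+2)!\,(2k+1)!}{2^{4k+3}}\,\square(q)^{8k+8}.$$ -/

import Mathlib

open Filter Topology Polynomial

namespace SumsOfSquares

noncomputable section

/-- The generating function of squares, the sum of `q ^ (n ^ 2)` over all integers `n`. -/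
def square (q : ℝ) : ℝ := ∑' n : ℤ, q ^ (n.natAbs ^ 2)

/-- The series `c 1 + c 2 + c 3 + ⋯` is Abel summable: the power series `∑_{k ≥ 1} t ^ k * c k`
converges for `0 < t < 1`, and its sum has a (finite) limit as `t → 1⁻`. -/
def AbelSummable (c : ℕ → ℝ) : Prop :=
  (∀ t : ℝ, 0 < t → t < 1 → Summable fun k : ℕ => t ^ (k + 1) * c (k + 1)) ∧
    ∃ a : ℝ, Tendsto (fun t : ℝ => ∑' k : ℕ, t ^ (k + 1) * c (k + 1)) (𝓝[<] 1) (𝓝 a)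

/-- The Abel mean of `c 1 + c 2 + c 3 + ⋯`, that is, the limit as `t → 1⁻` of
`∑_{k ≥ 1} t ^ k * c k` (meaningful when `c` is `AbelSummable`). -/
def abelMean (c : ℕ → ℝ) : ℝ :=
  limUnder (𝓝[<] (1 : ℝ)) fun t : ℝ => ∑' k : ℕ, t ^ (k + 1) * c (k + 1)

/-- The `k`-th term of the series defining `nuZero`. -/
def nuZeroTerm (q : ℝ) (f : ℝ[X]) (k : ℕ) : ℝ :=
  (1 - (-q) ^ k) / (1 + (-q) ^ k) * (-1) ^ (k + 1) * (k : ℝ) * f.eval ((k : ℝ) ^ 2)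

/-- The `k`-th term of the series defining `nuOne`. -/
def nuOneTerm (q : ℝ) (f : ℝ[X]) (k : ℕ) : ℝ :=
  (1 + (-q) ^ k) / (1 - (-q) ^ k) * (-1) ^ k * (k : ℝ) ^ 3 * f.eval ((k : ℝ) ^ 2)

/-- The moment functional `ν₀`. -/
def nuZero (q : ℝ) (f : ℝ[X]) : ℝ := 2 * abelMean (nuZeroTerm q f)

/-- The moment functional `ν₁`. -/
def nuOne (q : ℝ) (f : ℝ[X]) : ℝ := 2 * abelMean (nuOneTerm q f)

/-- `p` is a system of monic orthogonal polynomials for the functional `ν`: each `p k` is monic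
of degree `k`, and `ν (p j * p k) = 0` for `j ≠ k`. -/
def IsMonicOrthogonal (ν : ℝ[X] → ℝ) (p : ℕ → ℝ[X]) : Prop :=
  (∀ k, (p k).Monic ∧ (p k).natDegree = k) ∧ ∀ j k, j ≠ k → ν (p j * p k) = 0

/-- The squared norm `‖f‖² = ν (f²)` with respect to the functional `ν`. -/
def normSq (ν : ℝ[X] → ℝ) (f : ℝ[X]) : ℝ := ν (f * f)

end

end SumsOfSquares

/-! Put p = -q and F(z) = ∑ z^k / (1 + p^k) over all integers k, on |p| < |z| < 1. Partial fractions
make the convolutions behind F² and F³ telescope: F² has coefficients n / (1 - p^n) apart from a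
constant term (`tsum_plus_conv_plus`), and F³ has coefficients (n²/2 + c) / (1 + p^n)
(`tsum_plusSq_conv_plus`). With D = z d/dz this says F³ = D²F/2 + cF.

Taking Taylor coefficients of Y(x) = F(-e^x) at x = 0, as limits z → -1, gives a formal power series
with Y(0) = 0 and Y'' = AY + 2Y³. The odd coefficients of Y are the moments of ν₀ and the even
coefficients of Y² those of ν₁, up to explicit factors (`IsMomentSeries`). Thus ν₀(f) = -2
(f(D²)Y)'(0) and ν₁(f) = 2 (f(D²)(Y²)')'(0), where D is now d/dx.

The first integral Y'² = Y'(0)² + AY² + Y⁴ turns D² into a three-term recurrence on powers of Y of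
one parity (`IsMomentSeries.derivative_two_pow`). Hence monic polynomials carry Y to (2k)! Y^(2k+1),
and (Y²)' to (2k+1)! (Y^(2k+2))'. These vanish at 0 to high order, which is orthogonality; their
leading coefficients give the norms as powers of Y'(0) (`existsUnique_isMonicOrthogonal`).

It remains to see that Y'(0) = -□(q)⁴/4, which is Jacobi's four-square theorem (`four_squares`). It
follows from the two-square theorem (`square_sq`) and the formula for F², now with p = q² and z = q.
-/

namespace SumsOfSquares

/-! ### Abel means of (-1)^k k^N -/

/-- The sum of `(-t) ^ k * k ^ N` over `k ≥ 1`. -/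
noncomputable def altPow (N : ℕ) (t : ℝ) : ℝ := ∑' k : ℕ, ((k : ℝ) + 1) ^ N * (-t) ^ (k + 1)

lemma summable_succ_pow_mul_geometric (N : ℕ) {x : ℝ} (hx : |x| < 1) :
    Summable fun k : ℕ => ((k : ℝ) + 1) ^ N * x ^ (k + 1) := by
  have h := summable_pow_mul_geometric_of_norm_lt_one (R := ℝ) N (r := x) hx
  simpa using (summable_nat_add_iff 1).2 h

/-- Split off the first term, shift the index and expand by the binomial theorem. -/
lemma altPow_recurrence (N : ℕ) {t : ℝ} (ht : |t| < 1) :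
    altPow N t = -t - t * ∑ i ∈ Finset.range (N + 1), (N.choose i : ℝ) * altPow i t := by
  have hx : |(-t)| < 1 := by rwa [abs_neg]
  have hs := summable_succ_pow_mul_geometric N hx
  rw [altPow, hs.tsum_eq_zero_add]
  have h1 : ∀ k : ℕ, (((k + 1 : ℕ) : ℝ) + 1) ^ N * (-t) ^ (k + 1 + 1) =
      (-t) * ∑ i ∈ Finset.range (N + 1), (N.choose i : ℝ) * (((k : ℝ) + 1) ^ i * (-t) ^ (k + 1)) := by
    intro k
    rw [add_pow]
    push_cast
    simp only [Finset.mul_sum, Finset.sum_mul]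
    refine Finset.sum_congr rfl fun i _ => ?_
    ring
  simp only [h1]
  rw [tsum_mul_left, Summable.tsum_finsetSum
    (fun i _ => (summable_succ_pow_mul_geometric i hx).mul_left _)]
  simp only [tsum_mul_left, altPow]
  simp
  ring

lemma eventually_abs_lt_one : ∀ᶠ t : ℝ in 𝓝[<] 1, |t| < 1 := by
  filter_upwards [Ioo_mem_nhdsLT (show (0 : ℝ) < 1 by norm_num)] with t ht
  rw [abs_lt]; constructor <;> linarith [ht.1, ht.2]

lemma altPow_tendsto_exists (N : ℕ) : ∃ e, Tendsto (altPow N) (𝓝[<] 1) (𝓝 e) := by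
  induction N using Nat.strong_induction_on with
  | _ N ih =>
    have h : ∃ s, Tendsto (fun t : ℝ => ∑ i ∈ Finset.range N, (N.choose i : ℝ) * altPow i t)
        (𝓝[<] 1) (𝓝 s) := by
      choose! e he using ih
      exact ⟨_, tendsto_finsetSum _ fun i hi =>
        (he i (Finset.mem_range.1 hi)).const_mul (N.choose i : ℝ)⟩
    obtain ⟨s, hs⟩ := h
    have hid : Tendsto (fun t : ℝ => t) (𝓝[<] (1 : ℝ)) (𝓝 1) := tendsto_id.mono_left inf_le_left
    -- In the recurrence the summand i = N is `altPow N t` itself; moved to the left it produces the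
    -- factor 1 + t, which tends to 2.
    refine ⟨(-1 - 1 * s) / (1 + 1), Tendsto.congr' ?_
      ((hid.neg.sub (hid.mul hs)).div (hid.const_add 1) (by norm_num))⟩
    filter_upwards [eventually_abs_lt_one] with t ht
    have h1 := altPow_recurrence N ht
    rw [Finset.sum_range_succ] at h1
    have h2 : (1 + t) ≠ 0 := by linarith [(abs_lt.1 ht).1]
    simp only [Pi.div_apply, Nat.choose_self, Nat.cast_one, one_mul] at h1 ⊢
    rw [div_eq_iff h2]
    linarith

/-- The Abel mean of `(-1) ^ k * k ^ N` over `k ≥ 1`. -/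
noncomputable def altMean (N : ℕ) : ℝ := (altPow_tendsto_exists N).choose

lemma altPow_tendsto (N : ℕ) : Tendsto (altPow N) (𝓝[<] 1) (𝓝 (altMean N)) :=
  (altPow_tendsto_exists N).choose_spec

lemma altMean_recurrence (N : ℕ) :
    altMean N = -1 - ∑ i ∈ Finset.range (N + 1), (N.choose i : ℝ) * altMean i := by
  have hid : Tendsto (fun t : ℝ => t) (𝓝[<] (1 : ℝ)) (𝓝 1) := tendsto_id.mono_left inf_le_left
  have h := hid.neg.sub (hid.mul (tendsto_finsetSum (Finset.range (N + 1)) fun i _ =>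
    (altPow_tendsto i).const_mul (N.choose i : ℝ)))
  rw [one_mul] at h
  refine tendsto_nhds_unique (altPow_tendsto N) (h.congr' ?_)
  filter_upwards [eventually_abs_lt_one] with t ht
  exact (altPow_recurrence N ht).symm

lemma altMean_zero : altMean 0 = -1 / 2 := by
  have := altMean_recurrence 0
  simp at this
  linarith

lemma altMean_one : altMean 1 = -1 / 4 := by
  have := altMean_recurrence 1
  simp [Finset.sum_range_succ, altMean_zero] at this
  linarith

/-! ### Abel means with geometrically small corrections -/

/-- The series `c 1 + c 2 + ⋯` is Abel summable with Abel mean `a`. -/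
def HasAbelMean (c : ℕ → ℝ) (a : ℝ) : Prop :=
  (∀ t : ℝ, 0 < t → t < 1 → Summable fun k : ℕ => t ^ (k + 1) * c (k + 1)) ∧
    Tendsto (fun t : ℝ => ∑' k : ℕ, t ^ (k + 1) * c (k + 1)) (𝓝[<] 1) (𝓝 a)

lemma HasAbelMean.abelSummable {c : ℕ → ℝ} {a : ℝ} (h : HasAbelMean c a) : AbelSummable c :=
  ⟨h.1, a, h.2⟩

lemma HasAbelMean.abelMean_eq {c : ℕ → ℝ} {a : ℝ} (h : HasAbelMean c a) : abelMean c = a :=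
  h.2.limUnder_eq

lemma HasAbelMean.add {c d : ℕ → ℝ} {a b : ℝ} (hc : HasAbelMean c a) (hd : HasAbelMean d b) :
    HasAbelMean (fun k => c k + d k) (a + b) := by
  refine ⟨fun t h0 h1 => ((hc.1 t h0 h1).add (hd.1 t h0 h1)).congr fun k => by ring,
    (hc.2.add hd.2).congr' ?_⟩
  filter_upwards [Ioo_mem_nhdsLT (show (0 : ℝ) < 1 by norm_num)] with t ht
  rw [← (hc.1 t ht.1 ht.2).tsum_add (hd.1 t ht.1 ht.2)]
  exact tsum_congr fun k => by ring

lemma HasAbelMean.const_mul {c : ℕ → ℝ} {a : ℝ} (hc : HasAbelMean c a) (x : ℝ) :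
    HasAbelMean (fun k => x * c k) (x * a) := by
  refine ⟨fun t h0 h1 => ((hc.1 t h0 h1).mul_left x).congr fun k => by ring,
    (hc.2.const_mul x).congr fun t => ?_⟩
  rw [← tsum_mul_left]
  exact tsum_congr fun k => by ring

lemma HasAbelMean.congr {c d : ℕ → ℝ} {a : ℝ} (hc : HasAbelMean c a)
    (h : ∀ k : ℕ, c (k + 1) = d (k + 1)) : HasAbelMean d a := by
  simpa only [HasAbelMean, h] using hc

/-- The sum of `k ^ N * σ k * s ^ k` over `k ≥ 1`. -/
noncomputable def powSum (σ : ℕ → ℝ) (N : ℕ) (s : ℝ) : ℝ :=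
  ∑' k : ℕ, ((k : ℝ) + 1) ^ N * σ (k + 1) * s ^ (k + 1)

/-- `σ k` is bounded by a multiple of `|p| ^ k` for `k ≥ 1`. -/
def GeomBound (p : ℝ) (σ : ℕ → ℝ) : Prop :=
  |p| < 1 ∧ ∃ C : ℝ, ∀ k : ℕ, |σ (k + 1)| ≤ C * |p| ^ (k + 1)

lemma powSum_term_bound {p C : ℝ} {σ : ℕ → ℝ} (hC : ∀ k : ℕ, |σ (k + 1)| ≤ C * |p| ^ (k + 1))
    (N : ℕ) {s R : ℝ} (hs : |s| ≤ R) (k : ℕ) :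
    ‖((k : ℝ) + 1) ^ N * σ (k + 1) * s ^ (k + 1)‖ ≤
      C * (((k : ℝ) + 1) ^ N * (|p| * R) ^ (k + 1)) := by
  have hk : (0 : ℝ) ≤ (k : ℝ) + 1 := by positivity
  rw [norm_mul, norm_mul, norm_pow, norm_pow, Real.norm_eq_abs, Real.norm_eq_abs,
    Real.norm_eq_abs, abs_of_nonneg hk, mul_pow]
  calc ((k : ℝ) + 1) ^ N * |σ (k + 1)| * |s| ^ (k + 1)
      ≤ ((k : ℝ) + 1) ^ N * (C * |p| ^ (k + 1)) * R ^ (k + 1) := by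
        have := hC k
        have h0 := (abs_nonneg _).trans this
        gcongr
    _ = _ := by ring

lemma GeomBound.summable {p : ℝ} {σ : ℕ → ℝ} (h : GeomBound p σ) (N : ℕ) {s : ℝ}
    (hs : |p| * |s| < 1) :
    Summable fun k : ℕ => ((k : ℝ) + 1) ^ N * σ (k + 1) * s ^ (k + 1) := by
  obtain ⟨_, C, hC⟩ := h
  refine Summable.of_norm_bounded ?_ (powSum_term_bound hC N le_rfl)
  refine (summable_succ_pow_mul_geometric N ?_).mul_left C
  rwa [abs_of_nonneg (by positivity)]

lemma GeomBound.tendsto_powSum {p : ℝ} {σ : ℕ → ℝ} (h : GeomBound p σ) (N : ℕ) :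
    Tendsto (powSum σ N) (𝓝 (-1)) (𝓝 (powSum σ N (-1))) := by
  obtain ⟨hp, C, hC⟩ := h
  -- A radius R with 1 < R and |p|R < 1 gives one summable bound on a whole neighbourhood of -1.
  obtain ⟨R, hR1, hR⟩ : ∃ R : ℝ, 1 < R ∧ |p| * R < 1 := by
    refine ⟨2 / (1 + |p|), ?_, ?_⟩
    · rw [lt_div_iff₀ (by positivity)]; linarith
    · rw [← mul_div_assoc, div_lt_one (by positivity)]; linarith
  refine tendsto_tsum_of_dominated_convergence
    (bound := fun k : ℕ => C * (((k : ℝ) + 1) ^ N * (|p| * R) ^ (k + 1))) ?_ ?_ ?_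
  · refine (summable_succ_pow_mul_geometric N ?_).mul_left C
    rwa [abs_of_nonneg (by positivity)]
  · intro k
    exact ((continuous_id.pow (k + 1)).tendsto (-1)).const_mul _
  · have : ∀ᶠ s : ℝ in 𝓝 (-1), |s| < R :=
      (continuous_abs.tendsto (-1 : ℝ)).eventually_lt_const (by simpa using hR1)
    filter_upwards [this] with s hs k
    exact powSum_term_bound hC N hs.le k

/-- The weight 1 contributes `altMean`; the part with σ is a power series converging beyond the unit
circle, hence continuous at -1. -/
lemma GeomBound.hasAbelMean {p : ℝ} {σ : ℕ → ℝ} (h : GeomBound p σ) (N : ℕ) :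
    HasAbelMean (fun k => (-1) ^ k * (k : ℝ) ^ N * (1 - 2 * σ k))
      (altMean N - 2 * powSum σ N (-1)) := by
  have key : ∀ t : ℝ, |t| < 1 →
      HasSum (fun k : ℕ => t ^ (k + 1) * ((-1) ^ (k + 1) * ((k + 1 : ℕ) : ℝ) ^ N *
        (1 - 2 * σ (k + 1)))) (altPow N t - 2 * powSum σ N (-t)) := by
    intro t ht
    have hx : |(-t)| < 1 := by rwa [abs_neg]
    have h1 := (summable_succ_pow_mul_geometric N hx).hasSum
    have h2 := (h.summable N (s := -t) (by nlinarith [h.1, abs_nonneg p, abs_nonneg (-t)])).hasSum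
    refine (h1.sub (h2.mul_left 2)).congr_fun fun k => ?_
    rw [neg_pow t]
    push_cast
    ring
  refine ⟨fun t h0 h1 => (key t (by rw [abs_lt]; constructor <;> linarith)).summable, ?_⟩
  have hneg : Tendsto (fun t : ℝ => -t) (𝓝[<] 1) (𝓝 (-1)) :=
    (continuous_neg.tendsto 1).mono_left inf_le_left
  refine ((altPow_tendsto N).sub (((h.tendsto_powSum N).comp hneg).const_mul 2)).congr' ?_
  filter_upwards [eventually_abs_lt_one] with t ht
  exact (key t ht).tsum_eq.symm

/-! ### Laurent series on the annulus and their limits at -1 -/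

/-- A two-sided sequence with `B k + B (-k) = 1` and `B (-k) = σ k` for `k ≥ 1`. -/
def IsBilateral (B : ℤ → ℝ) (σ : ℕ → ℝ) : Prop :=
  ∀ k : ℕ, B ((k : ℤ) + 1) = 1 - σ (k + 1) ∧ B (-((k : ℤ) + 1)) = σ (k + 1)

/-- The positive indices converge for |z| < 1. The negative ones form a power series in z⁻¹ with
coefficients σ, which converges for |z| > |p|. -/
lemma IsBilateral.hasSum {B : ℤ → ℝ} {σ : ℕ → ℝ} {p z : ℝ} (hB : IsBilateral B σ)
    (h : GeomBound p σ) (N : ℕ) (hz : |z| < 1) (hpz : |p| < |z|) :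
    HasSum (fun k : ℤ => (k : ℝ) ^ N * B k * z ^ k)
      (0 ^ N * B 0 + (altPow N (-z) - powSum σ N z + (-1) ^ N * powSum σ N z⁻¹)) := by
  have hz0 : 0 < |z| := (abs_nonneg p).trans_lt hpz
  have h1 := (summable_succ_pow_mul_geometric N hz).hasSum
  have h2 := (h.summable N (s := z) (by nlinarith [h.1, abs_nonneg p])).hasSum
  have h3 := (h.summable N (s := z⁻¹) (by
    rw [abs_inv, ← div_eq_mul_inv, div_lt_one hz0]; exact hpz)).hasSum
  have hpos : HasSum (fun k : ℕ => (((k : ℤ) + 1 : ℤ) : ℝ) ^ N * B ((k : ℤ) + 1) *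
      z ^ ((k : ℤ) + 1)) (altPow N (-z) - powSum σ N z) := by
    have : altPow N (-z) = ∑' k : ℕ, ((k : ℝ) + 1) ^ N * z ^ (k + 1) := by simp [altPow]
    rw [this]
    refine (h1.sub h2).congr_fun fun k => ?_
    rw [(hB k).1]
    norm_cast
    push_cast
    ring
  have hneg : HasSum (fun k : ℕ => ((-((k : ℤ) + 1) : ℤ) : ℝ) ^ N * B (-((k : ℤ) + 1)) *
      z ^ (-((k : ℤ) + 1))) ((-1) ^ N * powSum σ N z⁻¹) := by
    refine (h3.mul_left ((-1) ^ N)).congr_fun fun k => ?_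
    rw [(hB k).2, zpow_neg, inv_pow]
    have h4 : ((-((k : ℤ) + 1) : ℤ) : ℝ) ^ N = (-1) ^ N * ((k : ℝ) + 1) ^ N := by
      rw [← mul_pow]; push_cast; ring
    have h5 : z ^ ((k : ℤ) + 1) = z ^ (k + 1) := by norm_cast
    rw [h4, h5]
    ring
  have := HasSum.of_add_one_of_neg_add_one (f := fun k : ℤ => (k : ℝ) ^ N * B k * z ^ k) hpos hneg
  convert this using 1
  simp
  ring

lemma IsBilateral.tendsto {B : ℤ → ℝ} {σ : ℕ → ℝ} {p : ℝ} (hB : IsBilateral B σ)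
    (h : GeomBound p σ) (N : ℕ) :
    Tendsto (fun t : ℝ => ∑' k : ℤ, (k : ℝ) ^ N * B k * (-t) ^ k) (𝓝[<] 1)
      (𝓝 (0 ^ N * B 0 + (altMean N - powSum σ N (-1) + (-1) ^ N * powSum σ N (-1)))) := by
  have hneg : Tendsto (fun t : ℝ => -t) (𝓝[<] 1) (𝓝 (-1)) :=
    (continuous_neg.tendsto 1).mono_left inf_le_left
  have hinv : Tendsto (fun t : ℝ => (-t)⁻¹) (𝓝[<] 1) (𝓝 (-1)) := by
    simpa using hneg.inv₀ (by norm_num)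
  have hs := h.tendsto_powSum N
  refine ((((altPow_tendsto N).sub (hs.comp hneg)).add
    ((hs.comp hinv).const_mul ((-1) ^ N))).const_add (0 ^ N * B 0)).congr' ?_
  filter_upwards [Ioo_mem_nhdsLT h.1] with t ht
  have ht0 : 0 < t := (abs_nonneg p).trans_lt ht.1
  have := hB.hasSum h N (z := -t) (by rw [abs_neg, abs_of_pos ht0]; exact ht.2)
    (by rw [abs_neg, abs_of_pos ht0]; exact ht.1)
  rw [this.tsum_eq]
  simp

/-! ### Products and telescoping of two-sided series -/

/-- The change of variables `(n, k) ↦ (k, n - k)` on pairs of integers. -/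
def convEquiv : ℤ × ℤ ≃ ℤ × ℤ where
  toFun x := (x.2, x.1 - x.2)
  invFun x := (x.1 + x.2, x.1)
  left_inv x := by ext <;> simp
  right_inv x := by ext <;> simp

lemma summable_conv {b c : ℤ → ℝ} {z : ℝ} (hz : z ≠ 0) (hb : Summable fun k : ℤ => b k * z ^ k)
    (hc : Summable fun k : ℤ => c k * z ^ k) (n : ℤ) :
    Summable fun k : ℤ => b k * c (n - k) := by
  have h := summable_mul_of_summable_norm hb.norm hc.norm
  have h2 := ((convEquiv.summable_iff.2 h).prod_factor n).mul_right (z ^ n)⁻¹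
  refine h2.congr fun k => ?_
  have hz1 : z ^ k * z ^ (n - k) = z ^ n := by rw [← zpow_add₀ hz]; congr 1; ring
  have hz2 : z ^ n ≠ 0 := zpow_ne_zero n hz
  simp only [convEquiv, Function.comp, Equiv.coe_fn_mk]
  rw [mul_mul_mul_comm, hz1, mul_inv_cancel_right₀ hz2]

lemma hasSum_prod_mul {f g : ℤ → ℝ} {a b : ℝ} (hf : HasSum f a) (hg : HasSum g b) :
    HasSum (fun x : ℤ × ℤ => f x.1 * g x.2) (a * b) :=
  hf.mul hg (summable_mul_of_summable_norm hf.summable.norm hg.summable.norm)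

lemma hasSum_conv_fiberwise {F : ℤ × ℤ → ℝ} {g : ℤ → ℝ} {s : ℝ} (hF : HasSum F s)
    (hg : ∀ n, HasSum (fun k => F (k, n - k)) (g n)) : HasSum g s :=
  (convEquiv.hasSum_iff.2 hF).prod_fiberwise hg

/-- This is the Leibniz rule for the N-th power of z d/dz, read on coefficients: expand (k + l)^N
over pairs and sum along k + l = n. -/
lemma hasSum_conv {b c : ℤ → ℝ} {z : ℝ} (hz : z ≠ 0) (N : ℕ)
    (hb : ∀ i ≤ N, Summable fun k : ℤ => (k : ℝ) ^ i * b k * z ^ k)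
    (hc : ∀ i ≤ N, Summable fun k : ℤ => (k : ℝ) ^ i * c k * z ^ k) :
    HasSum (fun n : ℤ => (n : ℝ) ^ N * (∑' k : ℤ, b k * c (n - k)) * z ^ n)
      (∑ ij ∈ Finset.HasAntidiagonal.antidiagonal N, (N.choose ij.1 : ℝ) *
        ((∑' k : ℤ, (k : ℝ) ^ ij.1 * b k * z ^ k) * ∑' k : ℤ, (k : ℝ) ^ ij.2 * c k * z ^ k)) := by
  have H : HasSum (fun x : ℤ × ℤ => ((x.1 : ℝ) + x.2) ^ N * (b x.1 * c x.2) * (z ^ x.1 * z ^ x.2))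
      (∑ ij ∈ Finset.HasAntidiagonal.antidiagonal N, (N.choose ij.1 : ℝ) *
        ((∑' k : ℤ, (k : ℝ) ^ ij.1 * b k * z ^ k) * ∑' k : ℤ, (k : ℝ) ^ ij.2 * c k * z ^ k)) := by
    have h1 : ∀ ij ∈ Finset.HasAntidiagonal.antidiagonal N, HasSum (fun x : ℤ × ℤ => (N.choose ij.1 : ℝ) *
        (((x.1 : ℝ) ^ ij.1 * b x.1 * z ^ x.1) * ((x.2 : ℝ) ^ ij.2 * c x.2 * z ^ x.2)))
        ((N.choose ij.1 : ℝ) * ((∑' k : ℤ, (k : ℝ) ^ ij.1 * b k * z ^ k) *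
          ∑' k : ℤ, (k : ℝ) ^ ij.2 * c k * z ^ k)) := by
      intro ij hij
      have h2 := hb ij.1 (by have := Finset.HasAntidiagonal.mem_antidiagonal.1 hij; omega)
      have h3 := hc ij.2 (by have := Finset.HasAntidiagonal.mem_antidiagonal.1 hij; omega)
      have h4 := hasSum_prod_mul h2.hasSum h3.hasSum
      have h5 := h4.mul_left (N.choose ij.1 : ℝ)
      exact h5
    have h6 := hasSum_sum h1
    convert h6 using 2 with x
    rw [(Commute.all (x.1 : ℝ) (x.2 : ℝ)).add_pow', Finset.sum_mul, Finset.sum_mul]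
    refine Finset.sum_congr rfl fun ij _ => ?_
    rw [nsmul_eq_mul]
    ring
  have H2 := fun g => hasSum_conv_fiberwise (g := g) H
  apply H2
  intro n
  have h4 := (summable_conv hz (by simpa using hb 0 (Nat.zero_le N))
    (by simpa using hc 0 (Nat.zero_le N)) n).hasSum
  have h5 := (h4.mul_left ((n : ℝ) ^ N)).mul_right (z ^ n)
  apply h5.congr_fun
  intro k
  have hz1 : z ^ k * z ^ (n - k) = z ^ n := by rw [← zpow_add₀ hz]; congr 1; ring
  rw [hz1]
  push_cast
  ring

lemma hasSum_int_telescope {f : ℤ → ℝ} (hs : Summable fun k : ℤ => f k - f (k - 1)) {a b : ℝ}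
    (ha : Tendsto (fun n : ℕ => f n) atTop (𝓝 a))
    (hb : Tendsto (fun n : ℕ => f (-(n : ℤ))) atTop (𝓝 b)) :
    HasSum (fun k : ℤ => f k - f (k - 1)) (a - b) := by
  have h1 : HasSum (fun n : ℕ => f ((n : ℤ) + 1) - f ((n : ℤ) + 1 - 1)) (a - f 0) := by
    have hsum : Summable (fun n : ℕ => f ((n : ℤ) + 1) - f ((n : ℤ) + 1 - 1)) :=
      hs.comp_injective (i := fun n : ℕ => (n : ℤ) + 1) fun x y h => by simpa using h
    rw [hsum.hasSum_iff_tendsto_nat]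
    refine (ha.sub_const (f 0)).congr fun n => ?_
    have := Finset.sum_range_sub (fun n : ℕ => f (n : ℤ)) n
    simp only [Nat.cast_zero] at this
    rw [← this]
    simp
  have h2 : HasSum (fun n : ℕ => f (-(n : ℤ)) - f (-(n : ℤ) - 1)) (f 0 - b) := by
    have hsum : Summable (fun n : ℕ => f (-(n : ℤ)) - f (-(n : ℤ) - 1)) :=
      hs.comp_injective (i := fun n : ℕ => -(n : ℤ)) fun x y h => by simpa using h
    rw [hsum.hasSum_iff_tendsto_nat]
    refine (hb.const_sub (f 0)).congr fun n => ?_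
    have := Finset.sum_range_sub' (fun n : ℕ => f (-(n : ℤ))) n
    simp only [Nat.cast_zero, neg_zero] at this
    rw [← this]
    refine Finset.sum_congr rfl fun i _ => ?_
    push_cast
    congr 2
    ring
  have h3 : HasSum (fun n : ℕ => f (-((n : ℤ) + 1)) - f (-((n : ℤ) + 1) - 1))
      (f 0 - b - (f 0 - f (-1))) := by
    have := (hasSum_nat_add_iff' 1).2 h2
    simpa using this
  have h4 := HasSum.of_add_one_of_neg_add_one (f := fun k : ℤ => f k - f (k - 1)) h1 h3
  convert h4 using 1
  simp

/-! ### The Laurent coefficients of F² and F³ -/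

/-- The coefficients `1 / (1 + p ^ k)`. -/
noncomputable def plusCoeff (p : ℝ) (k : ℤ) : ℝ := 1 / (1 + p ^ k)

/-- The coefficients `1 / (1 - p ^ k)`, with value `0` at `k = 0`. -/
noncomputable def minusCoeff (p : ℝ) (k : ℤ) : ℝ := 1 / (1 - p ^ k)

section

variable {p : ℝ}

lemma abs_zpow_ne_one (hp : |p| < 1) {k : ℤ} (hk : k ≠ 0) : |p ^ k| ≠ 1 := by
  rw [abs_zpow]
  intro h
  exact hk ((zpow_eq_one_iff_right₀ (abs_nonneg p) hp.ne).1 h)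

lemma one_sub_zpow_ne_zero (hp : |p| < 1) {k : ℤ} (hk : k ≠ 0) : 1 - p ^ k ≠ 0 := by
  intro h
  apply abs_zpow_ne_one hp hk
  rw [← sub_eq_zero.1 h, abs_one]

lemma one_add_zpow_ne_zero (hp : |p| < 1) (k : ℤ) : 1 + p ^ k ≠ 0 := by
  rcases eq_or_ne k 0 with rfl | hk
  · norm_num
  intro h
  apply abs_zpow_ne_one hp hk
  rw [eq_neg_of_add_eq_zero_right h, abs_neg, abs_one]

lemma abs_pow_succ_le (hp : |p| < 1) (k : ℕ) : |p ^ (k + 1)| ≤ |p| := by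
  rw [abs_pow]
  exact pow_le_of_le_one (abs_nonneg p) hp.le (Nat.succ_ne_zero k)

lemma geomBound_plus (hp : |p| < 1) : GeomBound p fun k => p ^ k / (1 + p ^ k) := by
  refine ⟨hp, (1 - |p|)⁻¹, fun k => ?_⟩
  have h1 := abs_le.1 (abs_pow_succ_le hp k)
  have h2 : 1 - |p| ≤ 1 + p ^ (k + 1) := by linarith
  have h3 : 0 < 1 - |p| := by linarith
  rw [abs_div, abs_pow, abs_of_pos (h3.trans_le h2), div_eq_inv_mul]
  gcongr

lemma geomBound_minus (hp : |p| < 1) : GeomBound p fun k => -(p ^ k / (1 - p ^ k)) := by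
  refine ⟨hp, (1 - |p|)⁻¹, fun k => ?_⟩
  have h1 := abs_le.1 (abs_pow_succ_le hp k)
  have h2 : 1 - |p| ≤ 1 - p ^ (k + 1) := by linarith
  have h3 : 0 < 1 - |p| := by linarith
  rw [abs_neg, abs_div, abs_pow, abs_of_pos (h3.trans_le h2), div_eq_inv_mul]
  gcongr

lemma isBilateral_plus (hp0 : p ≠ 0) (hp : |p| < 1) :
    IsBilateral (plusCoeff p) fun k => p ^ k / (1 + p ^ k) := by
  intro k
  have h := one_add_zpow_ne_zero hp ((k : ℤ) + 1)
  have h5 : p ^ ((k : ℤ) + 1) = p ^ (k + 1) := by norm_cast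
  have h6 : p ^ (k + 1) ≠ 0 := pow_ne_zero _ hp0
  rw [plusCoeff, plusCoeff, zpow_neg]
  rw [h5] at h ⊢
  have h7 : p ^ (k + 1) + 1 ≠ 0 := by rwa [add_comm]
  constructor <;> field_simp <;> ring

lemma isBilateral_minus (hp0 : p ≠ 0) (hp : |p| < 1) :
    IsBilateral (minusCoeff p) fun k => -(p ^ k / (1 - p ^ k)) := by
  intro k
  have h := one_sub_zpow_ne_zero hp (k := (k : ℤ) + 1) (by omega)
  have h5 : p ^ ((k : ℤ) + 1) = p ^ (k + 1) := by norm_cast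
  have h6 : p ^ (k + 1) ≠ 0 := pow_ne_zero _ hp0
  rw [minusCoeff, minusCoeff, zpow_neg]
  rw [h5] at h ⊢
  have h7 : p ^ (k + 1) - 1 ≠ 0 := by rw [← neg_ne_zero]; simpa using h
  constructor
  · field_simp; ring
  · simp only []
    rw [← neg_div, div_eq_div_iff (by field_simp; exact div_ne_zero h7 h6) h]
    field_simp; ring

lemma summable_plus (hp0 : p ≠ 0) {z : ℝ} (hz : |z| < 1) (hpz : |p| < |z|) (N : ℕ) :
    Summable fun k : ℤ => (k : ℝ) ^ N * plusCoeff p k * z ^ k :=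
  have hp := hpz.trans hz
  ((isBilateral_plus hp0 hp).hasSum (geomBound_plus hp) N hz hpz).summable

lemma summable_minus (hp0 : p ≠ 0) {z : ℝ} (hz : |z| < 1) (hpz : |p| < |z|) (N : ℕ) :
    Summable fun k : ℤ => (k : ℝ) ^ N * minusCoeff p k * z ^ k :=
  have hp := hpz.trans hz
  ((isBilateral_minus hp0 hp).hasSum (geomBound_minus hp) N hz hpz).summable

lemma exists_annulus (hp : |p| < 1) : ∃ z : ℝ, z ≠ 0 ∧ |z| < 1 ∧ |p| < |z| := by
  obtain ⟨z, h1, h2⟩ := exists_between hp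
  have h0 := (abs_nonneg p).trans_lt h1
  exact ⟨z, h0.ne', by rwa [abs_of_pos h0], by rwa [abs_of_pos h0]⟩

lemma summable_plus_conv_plus (hp0 : p ≠ 0) (hp : |p| < 1) (n : ℤ) :
    Summable fun k : ℤ => plusCoeff p k * plusCoeff p (n - k) := by
  obtain ⟨z, hz0, hz1, hz2⟩ := exists_annulus hp
  exact summable_conv hz0 (by simpa using summable_plus hp0 hz1 hz2 0)
    (by simpa using summable_plus hp0 hz1 hz2 0) n

/-- Partial fractions in p^k; the convolution becomes a telescoping sum. -/
lemma plus_mul_plus (hp0 : p ≠ 0) (hp : |p| < 1) {n : ℤ} (hn : n ≠ 0) (k : ℤ) :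
    plusCoeff p k * plusCoeff p (n - k) =
      minusCoeff p n * (plusCoeff p k - plusCoeff p (k - n)) := by
  have h1 := one_add_zpow_ne_zero hp k
  have h2 := one_add_zpow_ne_zero hp (n - k)
  have h3 := one_add_zpow_ne_zero hp (k - n)
  have h4 := one_sub_zpow_ne_zero hp hn
  have hk : p ^ k ≠ 0 := zpow_ne_zero k hp0
  have hn : p ^ n ≠ 0 := zpow_ne_zero n hp0
  simp only [plusCoeff, minusCoeff]
  rw [zpow_sub₀ hp0] at h2 h3 ⊢
  rw [zpow_sub₀ hp0]
  have h5 : p ^ k + p ^ n ≠ 0 := by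
    intro h; apply h2; field_simp; simpa using h
  have h6 : p ^ n + p ^ k ≠ 0 := by rwa [add_comm]
  field_simp
  ring

lemma plusCoeff_neg (hp0 : p ≠ 0) (hp : |p| < 1) (k : ℤ) :
    plusCoeff p (-k) = 1 - plusCoeff p k := by
  have h1 := one_add_zpow_ne_zero hp k
  have hk : p ^ k ≠ 0 := zpow_ne_zero k hp0
  have h2 : p ^ k + 1 ≠ 0 := by rwa [add_comm]
  simp only [plusCoeff, zpow_neg]
  field_simp
  ring

lemma plusCoeff_tendsto (hp : |p| < 1) :
    Tendsto (fun n : ℕ => plusCoeff p n) atTop (𝓝 1) := by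
  have h := (tendsto_pow_atTop_nhds_zero_of_abs_lt_one hp).const_add 1
  simpa [plusCoeff] using h.inv₀ (by norm_num)

lemma plusCoeff_neg_tendsto (hp0 : p ≠ 0) (hp : |p| < 1) :
    Tendsto (fun n : ℕ => plusCoeff p (-(n : ℤ))) atTop (𝓝 0) := by
  simp only [plusCoeff_neg hp0 hp]
  simpa using (plusCoeff_tendsto hp).const_sub 1

lemma summable_plus_sub (hp0 : p ≠ 0) (hp : |p| < 1) :
    Summable fun k : ℤ => plusCoeff p k - plusCoeff p (k - 1) := by
  -- By the partial fraction with n = 1 these differences are multiples of convolution terms already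
  -- known to be summable.
  have h := (summable_plus_conv_plus hp0 hp 1).mul_left (minusCoeff p 1)⁻¹
  have h1 : minusCoeff p 1 ≠ 0 :=
    one_div_ne_zero (one_sub_zpow_ne_zero hp one_ne_zero)
  refine h.congr fun k => ?_
  rw [plus_mul_plus hp0 hp one_ne_zero, inv_mul_cancel_left₀ h1]

lemma hasSum_plus_sub_one (hp0 : p ≠ 0) (hp : |p| < 1) :
    HasSum (fun k : ℤ => plusCoeff p k - plusCoeff p (k - 1)) 1 := by
  simpa using hasSum_int_telescope (summable_plus_sub hp0 hp) (plusCoeff_tendsto hp)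
    (plusCoeff_neg_tendsto hp0 hp)

lemma hasSum_plus_sub (hp0 : p ≠ 0) (hp : |p| < 1) (n : ℤ) :
    HasSum (fun k : ℤ => plusCoeff p k - plusCoeff p (k - n)) n := by
  have h1 := hasSum_plus_sub_one hp0 hp
  have step : ∀ m : ℤ, HasSum (fun k : ℤ => plusCoeff p (k - m) - plusCoeff p (k - m - 1)) 1 := by
    intro m
    have h := (Equiv.subRight m).hasSum_iff.2 h1
    exact h
  induction n using Int.induction_on with
  | zero => simp
  | succ i ih =>
    have h := ih.add (step i)
    have e : (fun k : ℤ => plusCoeff p k - plusCoeff p (k - ((i : ℤ) + 1))) =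
        fun k : ℤ => plusCoeff p k - plusCoeff p (k - i) +
          (plusCoeff p (k - i) - plusCoeff p (k - i - 1)) := by
      funext k
      rw [show k - ((i : ℤ) + 1) = k - i - 1 by ring]
      ring
    rw [e, Int.cast_add, Int.cast_one]
    exact h
  | pred i ih =>
    have h := ih.sub (step (-(i : ℤ) - 1))
    have e : (fun k : ℤ => plusCoeff p k - plusCoeff p (k - (-(i : ℤ) - 1))) =
        fun k : ℤ => plusCoeff p k - plusCoeff p (k - -(i : ℤ)) -
          (plusCoeff p (k - (-(i : ℤ) - 1)) - plusCoeff p (k - (-(i : ℤ) - 1) - 1)) := by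
      funext k
      rw [show k - (-(i : ℤ) - 1) - 1 = k - -(i : ℤ) by ring]
      ring
    rw [e, Int.cast_sub, Int.cast_one]
    exact h

/-- The constant term of the square of the Laurent series with coefficients `plusCoeff p`. -/
noncomputable def plusSqConst (p : ℝ) : ℝ := ∑' k : ℤ, plusCoeff p k * plusCoeff p (-k)

/-- The coefficients of the square of the Laurent series with coefficients `plusCoeff p`. -/
noncomputable def plusSqCoeff (p : ℝ) (n : ℤ) : ℝ :=
  n * minusCoeff p n + if n = 0 then plusSqConst p else 0

lemma tsum_plus_conv_plus (hp0 : p ≠ 0) (hp : |p| < 1) (n : ℤ) :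
    ∑' k : ℤ, plusCoeff p k * plusCoeff p (n - k) = plusSqCoeff p n := by
  rcases eq_or_ne n 0 with rfl | hn
  · simp [plusSqCoeff, plusSqConst]
  · simp only [plus_mul_plus hp0 hp hn, tsum_mul_left, (hasSum_plus_sub hp0 hp n).tsum_eq]
    simp [plusSqCoeff, hn, mul_comm]

lemma summable_plusSq (hp0 : p ≠ 0) {z : ℝ} (hz : |z| < 1) (hpz : |p| < |z|) (N : ℕ) :
    Summable fun k : ℤ => (k : ℝ) ^ N * plusSqCoeff p k * z ^ k := by
  have h1 := summable_minus hp0 hz hpz (N + 1)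
  have h2 : Summable fun k : ℤ => (k : ℝ) ^ N * (if k = 0 then plusSqConst p else 0) * z ^ k :=
    summable_of_ne_finset_zero (s := {0}) fun k hk => by simp at hk; simp [hk]
  refine (h1.add h2).congr fun k => ?_
  rw [plusSqCoeff]
  ring

/-- The terms whose sum over `l` is, up to the factor `plusCoeff p n`, the `n`-th coefficient of
the product of the Laurent series with coefficients `plusCoeff p k` and `k * minusCoeff p k`. -/
noncomputable def cubicTerm (p : ℝ) (n l : ℤ) : ℝ :=
  l * (plusCoeff p (n - l) + p ^ l * minusCoeff p l)

/-- Once `plusCoeff p n` is factored out, n survives only in `plusCoeff p (n - l)`, so differencing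
in n removes the remaining l-dependent term. -/
lemma plus_mul_minus (hp0 : p ≠ 0) (hp : |p| < 1) (n l : ℤ) :
    plusCoeff p (n - l) * (l * minusCoeff p l) = plusCoeff p n * cubicTerm p n l := by
  rcases eq_or_ne l 0 with rfl | hl
  · simp [cubicTerm]
  have h1 := one_add_zpow_ne_zero hp n
  have h2 := one_add_zpow_ne_zero hp (n - l)
  have h4 := one_sub_zpow_ne_zero hp hl
  have hl : p ^ l ≠ 0 := zpow_ne_zero l hp0
  simp only [plusCoeff, minusCoeff, cubicTerm]
  rw [zpow_sub₀ hp0] at h2 ⊢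
  have h5 : p ^ l + p ^ n ≠ 0 := by
    intro h; apply h2; field_simp; simpa using h
  field_simp
  ring

lemma plusCoeff_ne_zero (hp : |p| < 1) (n : ℤ) : plusCoeff p n ≠ 0 :=
  one_div_ne_zero (one_add_zpow_ne_zero hp n)

lemma summable_cubicTerm (hp0 : p ≠ 0) (hp : |p| < 1) (n : ℤ) :
    Summable (cubicTerm p n) := by
  obtain ⟨z, hz0, hz1, hz2⟩ := exists_annulus hp
  have h := (summable_conv (b := fun l : ℤ => l * minusCoeff p l) (c := plusCoeff p) hz0
    (by simpa using summable_minus hp0 hz1 hz2 1)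
    (by simpa using summable_plus hp0 hz1 hz2 0) n).mul_left (plusCoeff p n)⁻¹
  refine h.congr fun l => ?_
  rw [mul_comm _ (plusCoeff p (n - l)), plus_mul_minus hp0 hp,
    inv_mul_cancel_left₀ (plusCoeff_ne_zero hp n)]

lemma cubicTerm_sub (n l : ℤ) : cubicTerm p n l - cubicTerm p (n - 1) l =
    l * (plusCoeff p (n - l) - plusCoeff p (n - l - 1)) := by
  rw [cubicTerm, cubicTerm, show n - 1 - l = n - l - 1 by ring]
  ring

lemma hasSum_mul_plus_sub (hp0 : p ≠ 0) (hp : |p| < 1) :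
    HasSum (fun k : ℤ => (k : ℝ) * (plusCoeff p k - plusCoeff p (k - 1))) (1 / 2) := by
  have hs : Summable fun k : ℤ => (k : ℝ) * (plusCoeff p k - plusCoeff p (k - 1)) := by
    have h := ((summable_cubicTerm hp0 hp 0).sub (summable_cubicTerm hp0 hp (0 - 1))).neg
    rw [← (Equiv.neg ℤ).summable_iff]
    refine h.congr fun l => ?_
    rw [cubicTerm_sub]
    simp
  obtain ⟨s, hs⟩ := hs
  -- The substitution k ↦ 1 - k preserves the differences by `plusCoeff_neg` and sends the sum s to
  -- 1 - s.
  have h1 := (Equiv.subLeft (1 : ℤ)).hasSum_iff.2 hs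
  have h2 := (hasSum_plus_sub_one hp0 hp).sub hs
  have h3 : s = 1 - s := h1.unique (h2.congr_fun fun k => by
    simp only [Function.comp, Equiv.subLeft_apply]
    rw [show (1 - k : ℤ) - 1 = -k by ring, show (1 - k : ℤ) = -(k - 1) by ring,
      plusCoeff_neg hp0 hp, plusCoeff_neg hp0 hp]
    push_cast
    ring)
  rwa [show (1 / 2 : ℝ) = s by linarith]

lemma tsum_cubicTerm_sub (hp0 : p ≠ 0) (hp : |p| < 1) (n : ℤ) :
    ∑' l, cubicTerm p n l - ∑' l, cubicTerm p (n - 1) l = n - 1 / 2 := by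
  rw [← (summable_cubicTerm hp0 hp n).tsum_sub (summable_cubicTerm hp0 hp (n - 1))]
  have h := ((hasSum_plus_sub_one hp0 hp).mul_left (n : ℝ)).sub (hasSum_mul_plus_sub hp0 hp)
  rw [mul_one] at h
  have h2 := (Equiv.subLeft n).hasSum_iff.2 h
  rw [← h2.tsum_eq]
  refine tsum_congr fun l => ?_
  rw [cubicTerm_sub]
  simp only [Function.comp, Equiv.subLeft_apply]
  push_cast
  ring

/-- The first differences in n are n - 1/2, which are those of n²/2. -/
lemma tsum_cubicTerm (hp0 : p ≠ 0) (hp : |p| < 1) (n : ℤ) :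
    ∑' l, cubicTerm p n l = n ^ 2 / 2 + ∑' l, cubicTerm p 0 l := by
  induction n using Int.induction_on with
  | zero => simp
  | succ i ih =>
    have := tsum_cubicTerm_sub hp0 hp ((i : ℤ) + 1)
    rw [add_sub_cancel_right] at this
    push_cast at *
    linarith
  | pred i ih =>
    have := tsum_cubicTerm_sub hp0 hp (-(i : ℤ))
    push_cast at *
    linarith

/-- Coefficient form of F³ = D²F/2 + cF; c collects the sum of `cubicTerm` at n = 0 and the constant
term of F². -/
lemma tsum_plusSq_conv_plus (hp0 : p ≠ 0) (hp : |p| < 1) (n : ℤ) :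
    ∑' k : ℤ, plusSqCoeff p k * plusCoeff p (n - k) =
      ((n : ℝ) ^ 2 / 2 + (∑' l, cubicTerm p 0 l + plusSqConst p)) * plusCoeff p n := by
  have h1 := ((summable_cubicTerm hp0 hp n).hasSum).mul_left (plusCoeff p n)
  have h2 : HasSum (fun k : ℤ => (if k = 0 then plusSqConst p else 0) * plusCoeff p (n - k))
      (plusSqConst p * plusCoeff p n) := by
    convert hasSum_single (f := fun k : ℤ => (if k = 0 then plusSqConst p else 0) *
      plusCoeff p (n - k)) 0 (fun k hk => by simp [hk]) using 1
    simp
  rw [HasSum.tsum_eq ((h1.add h2).congr_fun fun k => by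
    rw [← plus_mul_minus hp0 hp, plusSqCoeff]; ring), tsum_cubicTerm hp0 hp]
  ring

end

/-! ### The moment series and its differential equation -/

/-- The exponential generating function of a real sequence. -/
noncomputable def egf (F : ℕ → ℝ) : PowerSeries ℝ := PowerSeries.mk fun n => F n / n.factorial

lemma coeff_egf (F : ℕ → ℝ) (n : ℕ) : PowerSeries.coeff n (egf F) = F n / n.factorial :=
  PowerSeries.coeff_mk _ _

lemma egf_mul (F G : ℕ → ℝ) : egf F * egf G = egf fun N =>
    ∑ ij ∈ Finset.HasAntidiagonal.antidiagonal N, (N.choose ij.1 : ℝ) * (F ij.1 * G ij.2) := by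
  ext N
  rw [PowerSeries.coeff_mul, coeff_egf, Finset.sum_div]
  refine Finset.sum_congr rfl fun ij hij => ?_
  have h := Finset.HasAntidiagonal.mem_antidiagonal.1 hij
  subst h
  rw [coeff_egf, coeff_egf, Nat.cast_add_choose]
  have h1 : (ij.1.factorial : ℝ) ≠ 0 := by positivity
  have h2 : (ij.2.factorial : ℝ) ≠ 0 := by positivity
  have h3 : ((ij.1 + ij.2).factorial : ℝ) ≠ 0 := by positivity
  field_simp

lemma derivative_egf (F : ℕ → ℝ) :
    PowerSeries.derivative ℝ (egf F) = egf fun n => F (n + 1) := by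
  ext n
  rw [PowerSeries.coeff_derivative, coeff_egf, coeff_egf, Nat.factorial_succ]
  have h1 : (n.factorial : ℝ) ≠ 0 := by positivity
  have h2 : (n : ℝ) + 1 ≠ 0 := by positivity
  push_cast
  field_simp

/-- The limits as `t → 1` of the sums of `k ^ N * plusCoeff p k * (-t) ^ k` over all integers. -/
noncomputable def plusMoment (p : ℝ) (N : ℕ) : ℝ :=
  0 ^ N * (1 / 2) + (altMean N - powSum (fun k => p ^ k / (1 + p ^ k)) N (-1) +
    (-1) ^ N * powSum (fun k => p ^ k / (1 + p ^ k)) N (-1))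

/-- The limits as `t → 1` of the sums of `k ^ N * minusCoeff p k * (-t) ^ k` over all integers. -/
noncomputable def minusMoment (p : ℝ) (N : ℕ) : ℝ :=
  altMean N - powSum (fun k => -(p ^ k / (1 - p ^ k))) N (-1) +
    (-1) ^ N * powSum (fun k => -(p ^ k / (1 - p ^ k))) N (-1)

section

variable {p : ℝ}

lemma tendsto_plus (hp0 : p ≠ 0) (hp : |p| < 1) (N : ℕ) :
    Tendsto (fun t : ℝ => ∑' k : ℤ, (k : ℝ) ^ N * plusCoeff p k * (-t) ^ k) (𝓝[<] 1)
      (𝓝 (plusMoment p N)) := by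
  have h := (isBilateral_plus hp0 hp).tendsto (geomBound_plus hp) N
  have h0 : plusCoeff p 0 = 1 / 2 := by norm_num [plusCoeff]
  rwa [h0] at h

lemma tendsto_minus (hp0 : p ≠ 0) (hp : |p| < 1) (N : ℕ) :
    Tendsto (fun t : ℝ => ∑' k : ℤ, (k : ℝ) ^ N * minusCoeff p k * (-t) ^ k) (𝓝[<] 1)
      (𝓝 (minusMoment p N)) := by
  have h := (isBilateral_minus hp0 hp).tendsto (geomBound_minus hp) N
  have h0 : minusCoeff p 0 = 0 := by norm_num [minusCoeff]
  rwa [h0, mul_zero, zero_add] at h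

lemma eventually_annulus (hp : |p| < 1) :
    ∀ᶠ t : ℝ in 𝓝[<] 1, -t ≠ 0 ∧ |(-t)| < 1 ∧ |p| < |(-t)| := by
  filter_upwards [Ioo_mem_nhdsLT hp] with t ht
  have ht0 : 0 < t := (abs_nonneg p).trans_lt ht.1
  rw [abs_neg, abs_of_pos ht0]
  exact ⟨by linarith, ht.2, ht.1⟩

lemma tendsto_plusSq (hp0 : p ≠ 0) (hp : |p| < 1) (N : ℕ) :
    Tendsto (fun t : ℝ => ∑' k : ℤ, (k : ℝ) ^ N * plusSqCoeff p k * (-t) ^ k) (𝓝[<] 1)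
      (𝓝 (minusMoment p (N + 1) + 0 ^ N * plusSqConst p)) := by
  refine ((tendsto_minus hp0 hp (N + 1)).add_const _).congr' ?_
  filter_upwards [eventually_annulus hp] with t ht
  have h1 := (summable_minus hp0 ht.2.1 ht.2.2 (N + 1)).hasSum
  have h2 := hasSum_single (f := fun k : ℤ =>
    (k : ℝ) ^ N * (if k = 0 then plusSqConst p else 0) * (-t) ^ k) 0 (fun k hk => by simp [hk])
  have h3 := (h1.add h2).tsum_eq
  simp only [Int.cast_zero, if_true, zpow_zero, mul_one] at h3
  rw [← h3]
  refine tsum_congr fun k => ?_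
  rw [plusSqCoeff]
  ring

/-- The product formula holds at every z = -t in the annulus, with binomial convolutions of sums;
the limit t → 1 turns it into an identity of generating functions. -/
lemma egf_plus_sq (hp0 : p ≠ 0) (hp : |p| < 1) :
    egf (plusMoment p) * egf (plusMoment p) =
      egf fun N => minusMoment p (N + 1) + 0 ^ N * plusSqConst p := by
  rw [egf_mul]
  congr 1
  funext N
  have h1 := tendsto_finsetSum (Finset.HasAntidiagonal.antidiagonal N) fun ij _ =>
    ((tendsto_plus hp0 hp ij.1).mul (tendsto_plus hp0 hp ij.2)).const_mul (N.choose ij.1 : ℝ)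
  refine tendsto_nhds_unique (h1.congr' ?_) (tendsto_plusSq hp0 hp N)
  filter_upwards [eventually_annulus hp] with t ht
  have h2 := hasSum_conv ht.1 N (fun i _ => summable_plus hp0 ht.2.1 ht.2.2 i)
    (fun i _ => summable_plus hp0 ht.2.1 ht.2.2 i)
  simp only [tsum_plus_conv_plus hp0 hp] at h2
  exact h2.tsum_eq.symm

lemma egf_plusSq_mul (hp0 : p ≠ 0) (hp : |p| < 1) :
    (egf fun N => minusMoment p (N + 1) + 0 ^ N * plusSqConst p) * egf (plusMoment p) =
      egf fun N => plusMoment p (N + 2) / 2 +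
        (∑' l, cubicTerm p 0 l + plusSqConst p) * plusMoment p N := by
  rw [egf_mul]
  congr 1
  funext N
  have h1 := tendsto_finsetSum (Finset.HasAntidiagonal.antidiagonal N) fun ij _ =>
    ((tendsto_plusSq hp0 hp ij.1).mul (tendsto_plus hp0 hp ij.2)).const_mul (N.choose ij.1 : ℝ)
  refine tendsto_nhds_unique (h1.congr' ?_) (((tendsto_plus hp0 hp (N + 2)).div_const 2).add
    ((tendsto_plus hp0 hp N).const_mul _))
  filter_upwards [eventually_annulus hp] with t ht
  have h2 := hasSum_conv ht.1 N (fun i _ => summable_plusSq hp0 ht.2.1 ht.2.2 i)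
    (fun i _ => summable_plus hp0 ht.2.1 ht.2.2 i)
  simp only [tsum_plusSq_conv_plus hp0 hp] at h2
  have h3 := ((summable_plus hp0 ht.2.1 ht.2.2 (N + 2)).hasSum.div_const 2).add
    ((summable_plus hp0 ht.2.1 ht.2.2 N).hasSum.mul_left
      (∑' l, cubicTerm p 0 l + plusSqConst p))
  rw [← h3.tsum_eq, ← h2.tsum_eq]
  refine tsum_congr fun k => ?_
  ring

end

/-- A formal power series `Y` with `Y(0) = 0` and `Y'' = A * Y + 2 * Y ^ 3`, whose odd coefficients
and the even coefficients of whose square are the Abel means defining `nuZero` and `nuOne`. -/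
structure IsMomentSeries (p A : ℝ) (Y : PowerSeries ℝ) : Prop where
  constantCoeff_eq : PowerSeries.constantCoeff Y = 0
  ode : PowerSeries.derivative ℝ (PowerSeries.derivative ℝ Y) = PowerSeries.C A * Y + 2 * Y ^ 3
  coeff_odd : ∀ n : ℕ, ((2 * n + 1).factorial : ℝ) * PowerSeries.coeff (2 * n + 1) Y =
    altMean (2 * n + 1) - 2 * powSum (fun k => p ^ k / (1 + p ^ k)) (2 * n + 1) (-1)
  coeff_sq : ∀ n : ℕ, ((2 * n + 2).factorial : ℝ) * PowerSeries.coeff (2 * n + 2) (Y ^ 2) =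
    altMean (2 * n + 3) - 2 * powSum (fun k => -(p ^ k / (1 - p ^ k))) (2 * n + 3) (-1)

lemma plusMoment_zero (p : ℝ) : plusMoment p 0 = 0 := by
  simp [plusMoment, altMean_zero]; norm_num

lemma plusMoment_odd (p : ℝ) (n : ℕ) : plusMoment p (2 * n + 1) =
    altMean (2 * n + 1) - 2 * powSum (fun k => p ^ k / (1 + p ^ k)) (2 * n + 1) (-1) := by
  have h : (-1 : ℝ) ^ (2 * n + 1) = -1 := Odd.neg_one_pow ⟨n, rfl⟩
  rw [plusMoment, h, pow_succ]
  ring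

lemma minusMoment_odd (p : ℝ) (n : ℕ) : minusMoment p (2 * n + 1) =
    altMean (2 * n + 1) - 2 * powSum (fun k => -(p ^ k / (1 - p ^ k))) (2 * n + 1) (-1) := by
  have h : (-1 : ℝ) ^ (2 * n + 1) = -1 := Odd.neg_one_pow ⟨n, rfl⟩
  rw [minusMoment, h]
  ring

/-- The relation F³ = D²F/2 + cF reads Y'' = -2cY + 2Y³, whence A = -2c. -/
lemma isMomentSeries_of_ne_zero {p : ℝ} (hp0 : p ≠ 0) (hp : |p| < 1) :
    IsMomentSeries p (-2 * (∑' l, cubicTerm p 0 l + plusSqConst p)) (egf (plusMoment p)) := by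
  have hsq := egf_plus_sq hp0 hp
  have hcube := egf_plusSq_mul hp0 hp
  refine ⟨?_, ?_, fun n => ?_, fun n => ?_⟩
  · rw [← PowerSeries.coeff_zero_eq_constantCoeff_apply, coeff_egf, plusMoment_zero, zero_div]
  · rw [← hsq] at hcube
    have h : (2 : PowerSeries ℝ) * egf (plusMoment p) ^ 3 =
        PowerSeries.derivative ℝ (PowerSeries.derivative ℝ (egf (plusMoment p))) +
          PowerSeries.C (2 * (∑' l, cubicTerm p 0 l + plusSqConst p)) * egf (plusMoment p) := by
      rw [show (2 : PowerSeries ℝ) * egf (plusMoment p) ^ 3 = PowerSeries.C 2 *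
        (egf (plusMoment p) * egf (plusMoment p) * egf (plusMoment p)) by
          rw [map_ofNat]; ring, hcube, derivative_egf, derivative_egf]
      ext n
      rw [map_add, PowerSeries.coeff_C_mul, PowerSeries.coeff_C_mul, coeff_egf, coeff_egf,
        coeff_egf]
      ring
    rw [h, neg_mul, map_neg]
    ring
  · rw [coeff_egf, mul_div_cancel₀ _ (by positivity), plusMoment_odd]
  · rw [pow_two, hsq, coeff_egf, mul_div_cancel₀ _ (by positivity),
      show 2 * n + 2 + 1 = 2 * (n + 1) + 1 by ring, minusMoment_odd]
    simp

/-- Generating-function form of `altMean_recurrence`: the series is -e^x / (1 + e^x). -/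
lemma altMean_egf_mul_exp :
    egf altMean * (1 + PowerSeries.exp ℝ) = -PowerSeries.exp ℝ := by
  have he : PowerSeries.exp ℝ = egf fun _ => 1 := by
    ext n; rw [PowerSeries.coeff_exp, coeff_egf]; simp
  rw [mul_add, mul_one, he, egf_mul]
  ext N
  have h := altMean_recurrence N
  have h2 := Finset.Nat.sum_antidiagonal_eq_sum_range_succ
    (fun i j => (N.choose i : ℝ) * (altMean i * 1)) N
  rw [map_add, map_neg, coeff_egf, coeff_egf, coeff_egf, h2]
  simp only [mul_one, Nat.succ_eq_add_one]
  rw [h]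
  ring

/-- For p = 0 the annulus argument breaks down, since p^k is needed for negative k. Here Y = (1 -
e^x) / (2(1 + e^x)) is explicit and satisfies Y' = Y² - 1/4, whose derivative gives the equation
with A = -1/2. -/
lemma isMomentSeries_zero : IsMomentSeries 0 (-1 / 2) (egf (plusMoment 0)) := by
  have hps : ∀ N, powSum (fun k => (0 : ℝ) ^ k / (1 + 0 ^ k)) N (-1) = 0 := fun N => by
    simp [powSum]
  have hms : ∀ N, powSum (fun k => -((0 : ℝ) ^ k / (1 - 0 ^ k))) N (-1) = 0 := fun N => by
    simp [powSum]
  set Y := egf (plusMoment 0) with hY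
  have hC : (PowerSeries.C (1 / 2 : ℝ)) * 2 = 1 := by
    rw [← map_ofNat (PowerSeries.C (R := ℝ)) 2, ← map_mul]; norm_num
  have h1 : Y = egf altMean + PowerSeries.C (1 / 2) := by
    ext N
    rw [hY, map_add, coeff_egf, coeff_egf, plusMoment, hps, PowerSeries.coeff_C]
    rcases N with _ | N
    · simp; ring
    · simp
  have h2 : 2 * (Y * (1 + PowerSeries.exp ℝ)) = 1 - PowerSeries.exp ℝ := by
    rw [h1, add_mul, altMean_egf_mul_exp]
    linear_combination (1 + PowerSeries.exp ℝ) * hC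
  have hD : PowerSeries.derivative ℝ (PowerSeries.exp ℝ) = PowerSeries.exp ℝ := by
    ext n
    rw [PowerSeries.coeff_derivative, PowerSeries.coeff_exp, PowerSeries.coeff_exp,
      Nat.factorial_succ]
    have h1 : (n.factorial : ℝ) ≠ 0 := by positivity
    have h2 : (n : ℝ) + 1 ≠ 0 := by positivity
    simp
    field_simp
  have hD2 : PowerSeries.derivative ℝ (2 : PowerSeries ℝ) = 0 := by
    rw [← map_ofNat (PowerSeries.C (R := ℝ)) 2, PowerSeries.derivative_C]
  have h3 : 2 * (PowerSeries.derivative ℝ Y * (1 + PowerSeries.exp ℝ) + Y * PowerSeries.exp ℝ) =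
      -PowerSeries.exp ℝ := by
    have := congrArg (PowerSeries.derivative ℝ) h2
    rw [Derivation.leibniz, Derivation.leibniz, map_add, map_sub, hD] at this
    simp only [smul_eq_mul, Derivation.map_one_eq_zero, hD2] at this
    linear_combination this
  have hexp : 1 + PowerSeries.exp ℝ ≠ 0 := by
    intro h
    have := congrArg (PowerSeries.constantCoeff (R := ℝ)) h
    simp at this
  have hC4 : (4 : PowerSeries ℝ) * PowerSeries.C (1 / 4 : ℝ) = 1 := by
    rw [← map_ofNat (PowerSeries.C (R := ℝ)) 4, ← map_mul]; norm_num
  -- Clear the denominator (1 + e^x)², then eliminate with the formula for Y and its derivative.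
  have h4 : 4 * PowerSeries.derivative ℝ Y = 4 * Y ^ 2 - 1 := by
    refine mul_right_cancel₀ (pow_ne_zero 2 hexp) ?_
    linear_combination 2 * (1 + PowerSeries.exp ℝ) * h3 -
      (2 * PowerSeries.exp ℝ + 1 - PowerSeries.exp ℝ + 2 * Y * (1 + PowerSeries.exp ℝ)) * h2
  have h5 : Y ^ 2 = PowerSeries.derivative ℝ Y + PowerSeries.C (1 / 4) := by
    linear_combination (-PowerSeries.C (1 / 4 : ℝ)) * h4 +
      (Y ^ 2 - PowerSeries.derivative ℝ Y) * (-hC4)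
  refine ⟨?_, ?_, fun n => ?_, fun n => ?_⟩
  · rw [← PowerSeries.coeff_zero_eq_constantCoeff_apply, coeff_egf, plusMoment_zero, zero_div]
  · have h6 := congrArg (PowerSeries.derivative ℝ) h5
    rw [map_add, Derivation.leibniz_pow, PowerSeries.derivative_C] at h6
    simp only [add_zero] at h6
    rw [← h6]
    have h7 : PowerSeries.C (-1 / 2 : ℝ) * 2 = -1 := by
      rw [← map_ofNat (PowerSeries.C (R := ℝ)) 2, ← map_mul]; norm_num
    have h8 : (2 : PowerSeries ℝ) * PowerSeries.C (1 / 4 : ℝ) = - PowerSeries.C (-1 / 2 : ℝ) := by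
      rw [← map_ofNat (PowerSeries.C (R := ℝ)) 2, ← map_mul, ← map_neg]; norm_num
    simp
    linear_combination (-2 * Y) * h5 - Y * h8
  · rw [coeff_egf, mul_div_cancel₀ _ (by positivity), plusMoment_odd]
  · rw [h5, map_add, PowerSeries.coeff_C, hY, derivative_egf, coeff_egf, if_neg (by omega), add_zero,
      mul_div_cancel₀ _ (by positivity), show 2 * n + 2 + 1 = 2 * (n + 1) + 1 by ring,
      plusMoment_odd, hps, hms]

lemma exists_isMomentSeries {p : ℝ} (hp : |p| < 1) : ∃ A Y, IsMomentSeries p A Y := by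
  rcases eq_or_ne p 0 with rfl | h
  · exact ⟨_, _, isMomentSeries_zero⟩
  · exact ⟨_, _, isMomentSeries_of_ne_zero h hp⟩

/-! ### Orthogonal polynomials from a three-term recurrence -/

section Algebra

variable {M : Type*} [AddCommGroup M] [Module ℝ M]

/-- A three-term recurrence for `T` along `u` produces monic polynomials carrying `u 0` to `u k`. -/
lemma exists_monic_aeval {T : Module.End ℝ M} {u : ℕ → M} {β γ : ℕ → ℝ}
    (h0 : T (u 0) = u 1 + β 0 • u 0)
    (h1 : ∀ k, T (u (k + 1)) = u (k + 2) + β (k + 1) • u (k + 1) + γ (k + 1) • u k) (k : ℕ) :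
    ∃ P : ℝ[X], (P.Monic ∧ P.natDegree = k) ∧ aeval T P (u 0) = u k := by
  have mono : ∀ {P Q : ℝ[X]} {b : ℝ} {k : ℕ}, (P.Monic ∧ P.natDegree = k) →
      Q.degree < ((k + 1 : ℕ) : WithBot ℕ) →
      (((X - C b) * P - Q).Monic ∧ ((X - C b) * P - Q).natDegree = k + 1) := by
    intro P Q b k hP hQ
    have hm : ((X - C b) * P).Monic := (monic_X_sub_C b).mul hP.1
    have hd : ((X - C b) * P).natDegree = k + 1 := by
      rw [(monic_X_sub_C b).natDegree_mul hP.1, natDegree_X_sub_C, hP.2, add_comm]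
    have hlt : Q.degree < ((X - C b) * P).degree := by
      rw [degree_eq_natDegree hm.ne_zero, hd]; exact hQ
    exact ⟨hm.sub_of_left hlt, by
      rw [natDegree_eq_of_degree_eq (degree_sub_eq_left_of_degree_lt hlt), hd]⟩
  suffices H : ∀ k, (∃ P : ℝ[X], (P.Monic ∧ P.natDegree = k) ∧ aeval T P (u 0) = u k) ∧
      ∃ P : ℝ[X], (P.Monic ∧ P.natDegree = k + 1) ∧ aeval T P (u 0) = u (k + 1) from (H k).1
  intro k
  induction k with
  | zero =>
    refine ⟨⟨1, ⟨monic_one, natDegree_one⟩, by simp⟩,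
      ⟨X - C (β 0), ⟨monic_X_sub_C _, natDegree_X_sub_C _⟩, ?_⟩⟩
    simp [h0, Module.algebraMap_end_apply]
  | succ k ih =>
    obtain ⟨⟨P, hP, hPu⟩, Q, hQ, hQu⟩ := ih
    refine ⟨⟨Q, hQ, hQu⟩, (X - C (β (k + 1))) * Q - C (γ (k + 1)) * P, mono hQ ?_, ?_⟩
    · rw [degree_lt_iff_coeff_zero]
      intro m hm
      rw [coeff_C_mul, coeff_eq_zero_of_natDegree_lt (by rw [hP.2]; omega), mul_zero]
    · simp only [map_sub, map_mul, LinearMap.sub_apply, Module.End.mul_apply, aeval_X, aeval_C,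
        hQu, hPu, h1, Module.algebraMap_end_apply]
      abel

/-- Linear functionals on polynomials are determined on monic orthogonal systems. -/
lemma isMonicOrthogonal_unique {ν : ℝ[X] →ₗ[ℝ] ℝ} {P Q : ℕ → ℝ[X]}
    (hP : IsMonicOrthogonal ν P) (hQ : IsMonicOrthogonal ν Q) (hn : ∀ k, ν (P k * P k) ≠ 0) :
    Q = P := by
  have span : ∀ (n : ℕ) (f : ℝ[X]), f.degree < (n : WithBot ℕ) →
      ∃ a : ℕ → ℝ, f = ∑ j ∈ Finset.range n, C (a j) * P j := by
    intro n
    induction n with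
    | zero =>
      intro f hf
      exact ⟨0, by simpa [Nat.WithBot.lt_zero_iff] using hf⟩
    | succ n ih =>
      intro f hf
      obtain ⟨a, ha⟩ := ih (f - C (f.coeff n) * P n) (by
        rw [degree_lt_iff_coeff_zero]
        intro m hm
        rcases hm.eq_or_lt with rfl | hm
        · have h1 : (P n).coeff n = 1 := by
            have := (hP.1 n).1.coeff_natDegree
            rwa [(hP.1 n).2] at this
          rw [coeff_sub, coeff_C_mul, h1]
          ring
        · have h1 : (P n).coeff m = 0 :=
            coeff_eq_zero_of_natDegree_lt (by rw [(hP.1 n).2]; exact hm)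
          rw [coeff_sub, coeff_C_mul, h1, (degree_lt_iff_coeff_zero f (n + 1)).1 hf m hm]
          ring)
      refine ⟨fun j => if j = n then f.coeff n else a j, ?_⟩
      have h1 : ∑ j ∈ Finset.range n, C (if j = n then f.coeff n else a j) * P j =
          f - C (f.coeff n) * P n := by
        rw [ha]
        exact Finset.sum_congr rfl fun j hj => by rw [if_neg (Finset.mem_range.1 hj).ne]
      simp only [Finset.sum_range_succ, h1, if_true]
      ring
  funext k
  induction k using Nat.strong_induction_on with
  | _ k ih =>
    obtain ⟨a, ha⟩ := span k (Q k - P k) (by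
      rw [degree_lt_iff_coeff_zero]
      intro m hm
      rcases hm.eq_or_lt with rfl | hm
      · have h1 := (hP.1 k).1.coeff_natDegree
        have h2 := (hQ.1 k).1.coeff_natDegree
        rw [(hP.1 k).2] at h1
        rw [(hQ.1 k).2] at h2
        rw [coeff_sub, h1, h2, sub_self]
      · rw [coeff_sub, coeff_eq_zero_of_natDegree_lt (by rw [(hQ.1 k).2]; exact hm),
          coeff_eq_zero_of_natDegree_lt (by rw [(hP.1 k).2]; exact hm), sub_self])
    -- For j < k both systems share their j-th member, so Q k - P k is orthogonal to P j, and the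
    -- nonzero norm forces its coefficient to vanish.
    have hz : ∀ j ∈ Finset.range k, a j = 0 := by
      intro j hj
      have hjk := Finset.mem_range.1 hj
      have h1 : ν ((Q k - P k) * P j) = 0 := by
        have h2 := hQ.2 k j hjk.ne'
        rw [ih j hjk] at h2
        rw [sub_mul, map_sub, h2, hP.2 k j hjk.ne', sub_zero]
      rw [ha, Finset.sum_mul, map_sum, Finset.sum_eq_single_of_mem j hj] at h1
      · rw [mul_assoc, ← smul_eq_C_mul, map_smul, smul_eq_mul] at h1
        exact (mul_eq_zero.1 h1).resolve_right (hn j)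
      · intro i _ hij
        rw [mul_assoc, ← smul_eq_C_mul, map_smul, hP.2 i j hij, smul_zero]
    rw [Finset.sum_eq_zero fun j hj => by rw [hz j hj, C_0, zero_mul]] at ha
    exact sub_eq_zero.1 ha

/-- The polynomials P k with P k(T) u 0 = u k give ν(f P k) = ℓ(f(T) u k). For deg f ≤ k only the
degree-k coefficient of f survives, which yields both orthogonality and norms. -/
lemma existsUnique_isMonicOrthogonal {ν : ℝ[X] →ₗ[ℝ] ℝ} {T : Module.End ℝ M} {ℓ : M →ₗ[ℝ] ℝ}
    {u : ℕ → M} {β γ h : ℕ → ℝ} (h0 : T (u 0) = u 1 + β 0 • u 0)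
    (h1 : ∀ k, T (u (k + 1)) = u (k + 2) + β (k + 1) • u (k + 1) + γ (k + 1) • u k)
    (hν : ∀ f, ν f = ℓ (aeval T f (u 0))) (hlt : ∀ i k, i < k → ℓ ((T ^ i) (u k)) = 0)
    (heq : ∀ k, ℓ ((T ^ k) (u k)) = h k) (hne : ∀ k, h k ≠ 0) :
    (∃! P, IsMonicOrthogonal ν P) ∧ ∀ P, IsMonicOrthogonal ν P → ∀ k, normSq ν (P k) = h k := by
  choose P hP hPu using exists_monic_aeval h0 h1
  have hmul : ∀ (f : ℝ[X]) (k : ℕ), f.natDegree ≤ k → ν (f * P k) = f.coeff k * h k := by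
    intro f k hf
    rw [hν, map_mul, Module.End.mul_apply, hPu, aeval_eq_sum_range' (Nat.lt_succ_of_le hf),
      LinearMap.sum_apply, map_sum, Finset.sum_range_succ, Finset.sum_eq_zero, zero_add]
    · rw [LinearMap.smul_apply, map_smul, heq, smul_eq_mul]
    · intro i hi
      rw [LinearMap.smul_apply, map_smul, hlt i k (Finset.mem_range.1 hi), smul_zero]
  have horth : ∀ j k, j < k → ν (P j * P k) = 0 := by
    intro j k hjk
    rw [hmul _ _ (by rw [(hP j).2]; exact hjk.le),
      coeff_eq_zero_of_natDegree_lt (by rw [(hP j).2]; exact hjk), zero_mul]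
  have hself : ∀ k, ν (P k * P k) = h k := by
    intro k
    have := (hP k).1.coeff_natDegree
    rw [(hP k).2] at this
    rw [hmul _ _ (hP k).2.le, this, one_mul]
  have hPo : IsMonicOrthogonal ν P := by
    refine ⟨hP, fun j k hjk => ?_⟩
    rcases hjk.lt_or_gt with h | h
    · exact horth j k h
    · rw [mul_comm]; exact horth k j h
  have huniq : ∀ Q, IsMonicOrthogonal ν Q → Q = P := fun Q hQ =>
    isMonicOrthogonal_unique hPo hQ fun k => by rw [hself]; exact hne k
  refine ⟨⟨P, hPo, huniq⟩, fun Q hQ k => ?_⟩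
  rw [huniq Q hQ]
  exact hself k

end Algebra

/-! ### Powers of the moment series under D² -/

section Series

variable {p A : ℝ} {Y : PowerSeries ℝ}

local notation "δ" => PowerSeries.derivative ℝ

/-- First integral of the differential equation: both sides have derivative 2Y'Y'' and the same
constant term. -/
lemma IsMomentSeries.derivative_sq (hY : IsMomentSeries p A Y) :
    (δ Y) ^ 2 = PowerSeries.C (PowerSeries.coeff 1 Y ^ 2) + PowerSeries.C A * Y ^ 2 + Y ^ 4 := by
  apply PowerSeries.derivative.ext
  · simp only [map_add, Derivation.leibniz_pow, Derivation.leibniz, PowerSeries.derivative_C,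
      hY.ode, smul_eq_mul, nsmul_eq_mul]
    push_cast
    ring
  · have h : PowerSeries.constantCoeff (δ Y) = PowerSeries.coeff 1 Y := by
      rw [← PowerSeries.coeff_zero_eq_constantCoeff_apply, PowerSeries.coeff_derivative]
      simp
    simp [hY.constantCoeff_eq, h]

/-- Expand the second derivative and eliminate Y'' by the equation and Y'² by its first integral. -/
lemma IsMomentSeries.derivative_two_pow (hY : IsMomentSeries p A Y) (j : ℕ) :
    δ (δ (Y ^ (j + 2))) = PowerSeries.C (((j : ℝ) + 2) * (j + 3)) * Y ^ (j + 4) +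
      PowerSeries.C (((j : ℝ) + 2) ^ 2 * A) * Y ^ (j + 2) +
      PowerSeries.C (((j : ℝ) + 2) * (j + 1) * PowerSeries.coeff 1 Y ^ 2) * Y ^ j := by
  have h := hY.derivative_sq
  simp only [map_add, Derivation.leibniz_pow, Derivation.leibniz, hY.ode, smul_eq_mul,
    nsmul_eq_mul, map_mul, map_pow, map_natCast, map_ofNat, Derivation.map_natCast, map_one] at h ⊢
  simp only [Nat.add_sub_cancel, show j + 2 - 1 = j + 1 by omega]
  push_cast
  linear_combination (((j : PowerSeries ℝ) + 2) * (j + 1)) * Y ^ j * h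

/-- The functional `f ↦ f'(0)` on formal power series. -/
noncomputable def derivAtZero : PowerSeries ℝ →ₗ[ℝ] ℝ := PowerSeries.coeff 1

/-- The second derivative as an endomorphism of the space of formal power series. -/
noncomputable def secondDeriv : Module.End ℝ (PowerSeries ℝ) :=
  (PowerSeries.derivative ℝ).toLinearMap * (PowerSeries.derivative ℝ).toLinearMap

lemma secondDeriv_apply (f : PowerSeries ℝ) : secondDeriv f = δ (δ f) := rfl

lemma coeff_secondDeriv_pow (f : PowerSeries ℝ) (i n : ℕ) :
    (n.factorial : ℝ) * PowerSeries.coeff n ((secondDeriv ^ i) f) =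
      ((2 * i + n).factorial : ℝ) * PowerSeries.coeff (2 * i + n) f := by
  induction i generalizing f with
  | zero => simp
  | succ i ih =>
    rw [pow_succ, Module.End.mul_apply, ih, secondDeriv_apply, PowerSeries.coeff_derivative,
      PowerSeries.coeff_derivative, show 2 * (i + 1) + n = 2 * i + n + 1 + 1 by ring,
      Nat.factorial_succ (2 * i + n + 1), Nat.factorial_succ (2 * i + n)]
    push_cast
    ring

lemma derivAtZero_secondDeriv_pow (f : PowerSeries ℝ) (i : ℕ) :
    derivAtZero ((secondDeriv ^ i) f) =
      ((2 * i + 1).factorial : ℝ) * PowerSeries.coeff (2 * i + 1) f := by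
  rw [← coeff_secondDeriv_pow]
  simp [derivAtZero]

lemma IsMomentSeries.coeff_pow_of_lt (hY : IsMomentSeries p A Y) {n m : ℕ} (h : n < m) :
    PowerSeries.coeff n (Y ^ m) = 0 :=
  PowerSeries.coeff_of_lt_order _ (lt_of_lt_of_le (by exact_mod_cast h)
    (PowerSeries.le_order_pow_of_constantCoeff_eq_zero m hY.constantCoeff_eq))

lemma IsMomentSeries.coeff_pow_self (hY : IsMomentSeries p A Y) (m : ℕ) :
    PowerSeries.coeff m (Y ^ m) = PowerSeries.coeff 1 Y ^ m := by
  obtain ⟨Z, hZ⟩ := PowerSeries.X_dvd_iff.2 hY.constantCoeff_eq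
  have h : PowerSeries.coeff m (PowerSeries.X ^ m * Z ^ m) = PowerSeries.coeff 0 (Z ^ m) := by
    have := PowerSeries.coeff_X_pow_mul (Z ^ m) m 0
    rwa [zero_add] at this
  have h1 : PowerSeries.coeff 1 (PowerSeries.X * Z) = PowerSeries.coeff 0 Z :=
    PowerSeries.coeff_succ_X_mul 0 Z
  rw [hZ, mul_pow, h, h1]
  simp

/-- The values of `nuZero` and `nuOne` on monomials, in terms of the moment series. -/
lemma IsMomentSeries.ell_zero (hY : IsMomentSeries p A Y) (n : ℕ) :
    derivAtZero ((secondDeriv ^ n) Y) =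
      altMean (2 * n + 1) - 2 * powSum (fun k => p ^ k / (1 + p ^ k)) (2 * n + 1) (-1) := by
  rw [derivAtZero_secondDeriv_pow, hY.coeff_odd]

lemma IsMomentSeries.ell_one (hY : IsMomentSeries p A Y) (n : ℕ) :
    derivAtZero ((secondDeriv ^ n) (δ (Y ^ 2))) =
      altMean (2 * n + 3) - 2 * powSum (fun k => -(p ^ k / (1 - p ^ k))) (2 * n + 3) (-1) := by
  rw [derivAtZero_secondDeriv_pow, PowerSeries.coeff_derivative, ← hY.coeff_sq,
    Nat.factorial_succ (2 * n + 1)]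
  push_cast
  ring

/-- The odd powers of the moment series, normalized. -/
noncomputable def oddPower (Y : PowerSeries ℝ) (k : ℕ) : PowerSeries ℝ :=
  ((2 * k).factorial : ℝ) • Y ^ (2 * k + 1)

/-- The derivatives of the even powers of the moment series, normalized. -/
noncomputable def evenPower (Y : PowerSeries ℝ) (k : ℕ) : PowerSeries ℝ :=
  ((2 * k + 1).factorial : ℝ) • δ (Y ^ (2 * k + 2))

lemma IsMomentSeries.secondDeriv_oddPower_zero (hY : IsMomentSeries p A Y) :
    secondDeriv (oddPower Y 0) = oddPower Y 1 + A • oddPower Y 0 := by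
  simp only [oddPower, secondDeriv_apply, PowerSeries.smul_eq_C_mul]
  have h2 : PowerSeries.C (2 : ℝ) = 2 := map_ofNat _ 2
  simp [hY.ode, h2]
  ring

/-- The factorial in `oddPower` absorbs the factor (2k+3)(2k+4) of the next power, so the recurrence
has leading coefficient 1 and yields monic polynomials. -/
lemma IsMomentSeries.secondDeriv_oddPower (hY : IsMomentSeries p A Y) (k : ℕ) :
    secondDeriv (oddPower Y (k + 1)) = oddPower Y (k + 2) +
      (((2 * k + 3 : ℕ) : ℝ) ^ 2 * A) • oddPower Y (k + 1) +
      (((2 * k + 3 : ℕ) : ℝ) * (2 * k + 2) * PowerSeries.coeff 1 Y ^ 2 *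
        ((2 * k + 2) * (2 * k + 1))) • oddPower Y k := by
  have h := hY.derivative_two_pow (2 * k + 1)
  simp only [oddPower]
  rw [map_smul, secondDeriv_apply, show 2 * (k + 1) + 1 = 2 * k + 1 + 2 by ring, h,
    show 2 * (k + 2) + 1 = 2 * k + 1 + 4 by ring,
    show 2 * (k + 2) = 2 * k + 1 + 1 + 1 + 1 by ring, show 2 * (k + 1) = 2 * k + 1 + 1 by ring]
  simp only [Nat.factorial_succ, PowerSeries.smul_eq_C_mul]
  push_cast
  simp only [map_mul, map_add, map_pow, map_one, map_natCast, map_ofNat]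
  ring

lemma IsMomentSeries.secondDeriv_evenPower_zero (hY : IsMomentSeries p A Y) :
    secondDeriv (evenPower Y 0) = evenPower Y 1 + (4 * A) • evenPower Y 0 := by
  have h := congrArg δ (hY.derivative_two_pow 0)
  simp only [evenPower, secondDeriv_apply, PowerSeries.smul_eq_C_mul]
  simp only [Nat.mul_zero, zero_add, Nat.factorial_one, Nat.cast_one, map_one, one_mul] at h ⊢
  rw [h]
  simp only [map_add, Derivation.leibniz, PowerSeries.derivative_C, smul_eq_mul, pow_zero,
    Derivation.map_one_eq_zero]
  norm_num [Nat.factorial]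

lemma IsMomentSeries.secondDeriv_evenPower (hY : IsMomentSeries p A Y) (k : ℕ) :
    secondDeriv (evenPower Y (k + 1)) = evenPower Y (k + 2) +
      (((2 * k + 4 : ℕ) : ℝ) ^ 2 * A) • evenPower Y (k + 1) +
      (((2 * k + 4 : ℕ) : ℝ) * (2 * k + 3) * PowerSeries.coeff 1 Y ^ 2 *
        ((2 * k + 3) * (2 * k + 2))) • evenPower Y k := by
  have h := congrArg δ (hY.derivative_two_pow (2 * k + 2))
  simp only [evenPower]
  rw [map_smul, secondDeriv_apply, show 2 * (k + 1) + 2 = 2 * k + 2 + 2 by ring, h,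
    show 2 * (k + 2) + 2 = 2 * k + 2 + 4 by ring,
    show 2 * (k + 2) + 1 = 2 * k + 1 + 1 + 1 + 1 + 1 by ring,
    show 2 * (k + 1) + 1 = 2 * k + 1 + 1 + 1 by ring]
  simp only [Nat.factorial_succ (2 * k + 1 + 1 + 1 + 1), Nat.factorial_succ (2 * k + 1 + 1 + 1),
    Nat.factorial_succ (2 * k + 1 + 1), Nat.factorial_succ (2 * k + 1),
    PowerSeries.smul_eq_C_mul, map_add, Derivation.leibniz, PowerSeries.derivative_C, smul_eq_mul]
  push_cast
  simp only [map_mul, map_add, map_pow, map_one, map_natCast, map_ofNat]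
  ring

/-- The functional reads the coefficient of degree 2i + 1, below the order 2k + 1 of vanishing of
Y^(2k+1). -/
lemma IsMomentSeries.ell_oddPower_of_lt (hY : IsMomentSeries p A Y) {i k : ℕ} (h : i < k) :
    derivAtZero ((secondDeriv ^ i) (oddPower Y k)) = 0 := by
  rw [oddPower, map_smul, map_smul, derivAtZero_secondDeriv_pow, hY.coeff_pow_of_lt (by omega),
    mul_zero, smul_zero]

lemma IsMomentSeries.ell_oddPower_self (hY : IsMomentSeries p A Y) (k : ℕ) :
    derivAtZero ((secondDeriv ^ k) (oddPower Y k)) =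
      (2 * k).factorial * (2 * k + 1).factorial * PowerSeries.coeff 1 Y ^ (2 * k + 1) := by
  rw [oddPower, map_smul, map_smul, derivAtZero_secondDeriv_pow, hY.coeff_pow_self, smul_eq_mul,
    mul_assoc]

lemma IsMomentSeries.ell_evenPower_of_lt (hY : IsMomentSeries p A Y) {i k : ℕ} (h : i < k) :
    derivAtZero ((secondDeriv ^ i) (evenPower Y k)) = 0 := by
  rw [evenPower, map_smul, map_smul, derivAtZero_secondDeriv_pow, PowerSeries.coeff_derivative,
    hY.coeff_pow_of_lt (by omega), zero_mul, mul_zero, smul_zero]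

lemma IsMomentSeries.ell_evenPower_self (hY : IsMomentSeries p A Y) (k : ℕ) :
    derivAtZero ((secondDeriv ^ k) (evenPower Y k)) =
      (2 * k + 1).factorial * (2 * k + 2).factorial * PowerSeries.coeff 1 Y ^ (2 * k + 2) := by
  rw [evenPower, map_smul, map_smul, derivAtZero_secondDeriv_pow, PowerSeries.coeff_derivative,
    hY.coeff_pow_self, smul_eq_mul, Nat.factorial_succ (2 * k + 1)]
  push_cast
  ring

end Series

/-! ### The two-square theorem -/

/-- The two-sided series with terms `z ^ k / (1 + z ^ (2 * k))`. -/
noncomputable def sechSum (z : ℝ) : ℝ := ∑' k : ℤ, plusCoeff (z ^ 2) k * z ^ k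

section

variable {z : ℝ}

lemma summable_pow_natAbs (hz : |z| < 1) : Summable fun k : ℤ => z ^ k.natAbs := by
  have h := summable_geometric_of_norm_lt_one (x := z) hz
  exact Summable.of_nat_of_neg (by simpa using h) (by simpa using h)

lemma summable_square (hz : |z| < 1) : Summable fun k : ℤ => z ^ (k.natAbs ^ 2) := by
  refine Summable.of_norm_bounded (summable_pow_natAbs (z := |z|) (by rwa [abs_abs])) fun k => ?_
  rw [norm_pow, Real.norm_eq_abs]
  exact pow_le_pow_of_le_one (abs_nonneg z) hz.le (Nat.le_self_pow two_ne_zero _)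

lemma square_lt_abs (hz0 : z ≠ 0) (hz : |z| < 1) : |z ^ 2| < |z| := by
  rw [abs_pow, pow_two]
  nlinarith [abs_pos.2 hz0]

lemma summable_sech (hz0 : z ≠ 0) (hz : |z| < 1) :
    Summable fun k : ℤ => plusCoeff (z ^ 2) k * z ^ k := by
  simpa using summable_plus (pow_ne_zero 2 hz0) hz (square_lt_abs hz0 hz) 0

lemma zpow_sq_eq (z : ℝ) (k : ℤ) : z ^ (k ^ 2) = z ^ (k.natAbs ^ 2) := by
  rw [← zpow_natCast]
  congr 1
  push_cast
  rw [sq_abs]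

/-- The coefficients `(-1) ^ k * z ^ (k ^ 2 - k)` of a theta series. -/
noncomputable def thetaCoeff (z : ℝ) (k : ℤ) : ℝ := (-1) ^ k * z ^ (k ^ 2 - k)

lemma thetaCoeff_mul_zpow (hz0 : z ≠ 0) (k : ℤ) :
    thetaCoeff z k * z ^ k = (-z) ^ (k.natAbs ^ 2) := by
  rw [thetaCoeff, mul_assoc, ← zpow_add₀ hz0, sub_add_cancel, ← zpow_sq_eq, neg_eq_neg_one_mul z,
    mul_zpow]
  congr 1
  rcases Int.even_or_odd k with h | h
  · rw [h.neg_one_zpow, (h.pow_of_ne_zero two_ne_zero).neg_one_zpow]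
  · rw [h.neg_one_zpow, h.pow.neg_one_zpow]

lemma thetaCoeff_neg (z : ℝ) (k : ℤ) : thetaCoeff (-z) k = thetaCoeff z k := by
  have h : Even (k ^ 2 - k) := by
    have := Int.even_mul_pred_self k
    rwa [show k * (k - 1) = k ^ 2 - k by ring] at this
  rw [thetaCoeff, thetaCoeff, h.neg_zpow]

lemma summable_theta (hz0 : z ≠ 0) (hz : |z| < 1) :
    Summable fun k : ℤ => thetaCoeff z k * z ^ k := by
  simp only [thetaCoeff_mul_zpow hz0]
  exact summable_square (by rwa [abs_neg])

/-- The coefficients of the product of the theta series and the `sech` series. -/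
noncomputable def thetaConv (z : ℝ) (m : ℤ) : ℝ :=
  ∑' k : ℤ, thetaCoeff z k * plusCoeff (z ^ 2) (m - k)

lemma summable_thetaConv (hz0 : z ≠ 0) (hz : |z| < 1) (m : ℤ) :
    Summable fun k : ℤ => thetaCoeff z k * plusCoeff (z ^ 2) (m - k) :=
  summable_conv hz0 (summable_theta hz0 hz) (summable_sech hz0 hz) m

/-- The involution k ↦ 1 - k fixes k² - k and reverses the sign. -/
lemma tsum_thetaCoeff (z : ℝ) : ∑' k : ℤ, thetaCoeff z k = 0 := by
  have h := (Equiv.subLeft (1 : ℤ)).tsum_eq (thetaCoeff z)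
  have h2 : ∀ k : ℤ, thetaCoeff z (Equiv.subLeft (1 : ℤ) k) = -thetaCoeff z k := by
    intro k
    rw [Equiv.subLeft_apply, thetaCoeff, thetaCoeff,
      show (1 - k : ℤ) ^ 2 - (1 - k) = k ^ 2 - k by ring, zpow_sub₀ (by norm_num), zpow_one]
    rcases Int.even_or_odd k with h | h
    · rw [h.neg_one_zpow]; norm_num
    · rw [h.neg_one_zpow]; norm_num
  simp only [h2, tsum_neg] at h
  linarith

lemma thetaConv_step (hz0 : z ≠ 0) (hz : |z| < 1) (m : ℤ) :
    thetaConv z (m + 1) = z ^ (2 * m) * thetaConv z m := by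
  have hp : |z ^ 2| < 1 := (square_lt_abs hz0 hz).trans hz
  have h1 := (summable_thetaConv hz0 hz (m + 1)).hasSum
  have h2 := ((summable_thetaConv hz0 hz m).hasSum.mul_left (-z ^ (2 * m)))
  have h3 := (Equiv.subRight (1 : ℤ)).hasSum_iff.2 h2
  have h4 := (h1.add h3).tsum_eq
  -- After the shift by 1 the two terms share the denominator 1 + (z²)^(m+1-k), which cancels; what
  -- is left sums to zero.
  have h5 : ∀ k : ℤ, thetaCoeff z k * plusCoeff (z ^ 2) (m + 1 - k) +
      ((fun i : ℤ => -z ^ (2 * m) * (thetaCoeff z i * plusCoeff (z ^ 2) (m - i))) ∘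
        Equiv.subRight (1 : ℤ)) k = thetaCoeff z k := by
    intro k
    have h6 := one_add_zpow_ne_zero hp (m + 1 - k)
    simp only [Function.comp, Equiv.subRight_apply]
    rw [show m - (k - 1) = m + 1 - k by ring]
    have h7 : -z ^ (2 * m) * thetaCoeff z (k - 1) = thetaCoeff z k * (z ^ 2) ^ (m + 1 - k) := by
      have h9 : (z ^ 2) ^ (m + 1 - k) = z ^ (2 * (m + 1 - k)) := by
        rw [zpow_mul]; norm_cast
      rw [thetaCoeff, thetaCoeff, h9, mul_assoc ((-1 : ℝ) ^ k), ← zpow_add₀ hz0, zpow_sub₀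
        (by norm_num : (-1 : ℝ) ≠ 0), zpow_one, div_neg, div_one, neg_mul, neg_mul, mul_neg, neg_neg,
        mul_left_comm, ← zpow_add₀ hz0]
      congr 2
      ring
    rw [← mul_assoc, h7, plusCoeff]
    field_simp
  simp only [h5, tsum_thetaCoeff z] at h4
  rw [thetaConv, thetaConv]
  linarith

lemma thetaConv_eq (hz0 : z ≠ 0) (hz : |z| < 1) (m : ℤ) :
    thetaConv z m = z ^ (m ^ 2 - m) * thetaConv z 0 := by
  induction m using Int.induction_on with
  | zero => simp
  | succ i ih =>
    rw [thetaConv_step hz0 hz, ih, ← mul_assoc, ← zpow_add₀ hz0]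
    congr 2
    ring
  | pred i ih =>
    have h := thetaConv_step hz0 hz (-(i : ℤ) - 1)
    rw [sub_add_cancel, ih] at h
    have h2 : z ^ (2 * (-(i : ℤ) - 1)) ≠ 0 := zpow_ne_zero _ hz0
    apply mul_left_cancel₀ h2
    rw [← h, ← mul_assoc, ← zpow_add₀ hz0]
    congr 2
    ring

/-- The product of the theta series and F (with p = z²) has m-th coefficient proportional to z^(m² -
m); evaluated at z it is a multiple of `square z`. -/
lemma square_neg_mul_sechSum (hz0 : z ≠ 0) (hz : |z| < 1) :
    square (-z) * sechSum z = thetaConv z 0 * square z := by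
  have h := hasSum_conv (b := thetaCoeff z) (c := plusCoeff (z ^ 2)) hz0 0
    (fun i hi => by obtain rfl := Nat.le_zero.1 hi; simpa using summable_theta hz0 hz)
    (fun i hi => by obtain rfl := Nat.le_zero.1 hi; simpa using summable_sech hz0 hz)
  have h1 := h.tsum_eq
  simp only [pow_zero, one_mul, Finset.Nat.antidiagonal_zero, Finset.sum_singleton,
    Nat.choose_zero_right, Nat.cast_one, thetaCoeff_mul_zpow hz0] at h1
  have h2 : ∀ m : ℤ, (∑' k : ℤ, thetaCoeff z k * plusCoeff (z ^ 2) (m - k)) * z ^ m =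
      thetaConv z 0 * z ^ (m.natAbs ^ 2) := by
    intro m
    have := thetaConv_eq hz0 hz m
    rw [thetaConv] at this
    rw [this, mul_right_comm, ← zpow_add₀ hz0, sub_add_cancel, zpow_sq_eq, mul_comm]
  simp only [h2, tsum_mul_left] at h1
  exact h1.symm

lemma thetaConv_neg (z : ℝ) : thetaConv (-z) 0 = thetaConv z 0 := by
  simp only [thetaConv, thetaCoeff_neg, neg_sq]

/-- Both sides equal `thetaConv z 0 * square z * square (-z)`, because `thetaConv z 0` is even in z.
-/
lemma sechSum_mul_square (hz0 : z ≠ 0) (hz : |z| < 1) :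
    sechSum z * square (-z) ^ 2 = sechSum (-z) * square z ^ 2 := by
  have h1 := square_neg_mul_sechSum hz0 hz
  have h2 := square_neg_mul_sechSum (z := -z) (neg_ne_zero.2 hz0) (by rwa [abs_neg])
  rw [neg_neg, thetaConv_neg] at h2
  linear_combination square (-z) * h1 - square z * h2

lemma sechSum_add_neg (hz0 : z ≠ 0) (hz : |z| < 1) :
    sechSum z + sechSum (-z) = 2 * sechSum (z ^ 2) := by
  have hz2 : |z ^ 2| < 1 := (square_lt_abs hz0 hz).trans hz
  have h1 := (summable_sech hz0 hz).hasSum.add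
    (summable_sech (z := -z) (neg_ne_zero.2 hz0) (by rwa [abs_neg])).hasSum
  have hinj : Function.Injective fun k : ℤ => 2 * k := fun a b h => by simpa using h
  have h2 := (hinj.hasSum_iff (fun k hk => by
    have hodd : Odd k := by
      rw [← Int.not_even_iff_odd]
      rintro ⟨j, rfl⟩
      exact hk ⟨j, by simp; ring⟩
    rw [neg_sq, hodd.neg_zpow]
    ring)).2 h1
  have h3 := ((summable_sech (pow_ne_zero 2 hz0) hz2).hasSum.mul_left 2)
  refine h2.unique ?_
  have h4 : ((fun k : ℤ => plusCoeff (z ^ 2) k * z ^ k + plusCoeff ((-z) ^ 2) k * (-z) ^ k) ∘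
      fun k : ℤ => 2 * k) = fun k : ℤ => 2 * (plusCoeff ((z ^ 2) ^ 2) k * (z ^ 2) ^ k) := by
    funext k
    have h5 : ∀ x : ℝ, x ^ (2 * k) = (x ^ 2) ^ k := fun x => by
      rw [zpow_mul]; norm_cast
    simp only [Function.comp, plusCoeff, neg_sq, h5]
    ring
  rw [h4]
  exact h3

/-- Pairs (a, b) with a² + b² odd cancel; the others are (c + d, c - d), with a² + b² = 2(c² + d²).
-/
lemma square_sq_add (hz : |z| < 1) :
    square z ^ 2 + square (-z) ^ 2 = 2 * square (z ^ 2) ^ 2 := by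
  have hz2 : |z ^ 2| < 1 := by rw [abs_pow]; exact pow_lt_one₀ (abs_nonneg z) hz two_ne_zero
  have hs := (summable_square hz).hasSum
  have hs' := (summable_square (z := -z) (by rwa [abs_neg])).hasSum
  have hs2 := (summable_square hz2).hasSum
  have h1 := (hasSum_prod_mul hs hs).add (hasSum_prod_mul hs' hs')
  have h3 := (hasSum_prod_mul hs2 hs2).mul_left 2
  have hinj : Function.Injective fun x : ℤ × ℤ => (x.1 + x.2, x.1 - x.2) := by
    rintro ⟨a, b⟩ ⟨c, d⟩ h
    simp only [Prod.mk.injEq] at h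
    ext <;> simp <;> omega
  have hpow : ∀ (x : ℝ) (a b : ℤ), x ^ (a.natAbs ^ 2) * x ^ (b.natAbs ^ 2) =
      x ^ (a.natAbs ^ 2 + b.natAbs ^ 2) := fun x a b => (pow_add _ _ _).symm
  have h2 := (hinj.hasSum_iff (fun x hx => by
    have hodd : Odd (x.1.natAbs ^ 2 + x.2.natAbs ^ 2) := by
      rw [← Nat.not_even_iff_odd]
      intro he
      have he' : Even (x.1 + x.2) := by
        rw [Nat.even_add, Nat.even_pow' two_ne_zero, Nat.even_pow' two_ne_zero, Int.natAbs_even,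
          Int.natAbs_even] at he
        exact Int.even_add.2 he
      obtain ⟨c, hc⟩ := he'
      exact hx ⟨(c, x.1 - c), Prod.ext (by simp) (by simp; omega)⟩
    rw [hpow, hpow, hodd.neg_pow]
    ring)).2 h1
  rw [pow_two, pow_two, pow_two]
  refine h2.unique ?_
  refine h3.congr_fun fun x => ?_
  simp only [Function.comp, hpow]
  have he : (x.1 + x.2).natAbs ^ 2 + (x.1 - x.2).natAbs ^ 2 =
      2 * (x.1.natAbs ^ 2 + x.2.natAbs ^ 2) := by
    zify
    simp only [sq_abs]
    ring
  rw [he, pow_mul, pow_mul, neg_sq]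
  ring

end

section

variable {q : ℝ}

lemma one_le_square (hq0 : 0 ≤ q) (hq1 : q < 1) : 1 ≤ square q := by
  have h := (summable_square (z := q) (by rwa [abs_of_nonneg hq0])).le_tsum 0
    (fun k _ => by positivity)
  simpa [square] using h

/-- The ratio of `sechSum` to the square of `square` is the same at q and -q, and numerator and
denominator have the same duplication formula. -/
lemma sechSum_sq_mul (hq0 : 0 < q) (hq1 : q < 1) :
    sechSum (q ^ 2) / square (q ^ 2) ^ 2 = sechSum q / square q ^ 2 := by
  have hz : |q| < 1 := by rwa [abs_of_pos hq0]
  have h1 := sechSum_mul_square hq0.ne' hz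
  have h2 := sechSum_add_neg hq0.ne' hz
  have h3 := square_sq_add hz
  have h4 := one_le_square hq0.le hq1
  have h5 := one_le_square (q := q ^ 2) (by positivity) (by nlinarith)
  rw [div_eq_div_iff (by positivity) (by positivity)]
  linear_combination (-1 / 2 * square q ^ 2) * h2 + (1 / 2 * sechSum q) * h3 - 1 / 2 * h1

lemma plusCoeff_mul_zpow_eq (hq0 : 0 < q) (k : ℤ) :
    plusCoeff (q ^ 2) k * q ^ k = q ^ k.natAbs / (1 + q ^ (2 * k.natAbs)) := by
  rcases Int.natAbs_eq k with h | h
  · rw [h, plusCoeff, zpow_natCast, zpow_natCast, Int.natAbs_natCast, pow_mul]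
    ring
  · rw [h, plusCoeff, zpow_neg, zpow_neg, zpow_natCast, zpow_natCast, Int.natAbs_neg,
      Int.natAbs_natCast, pow_mul, ← pow_mul, mul_comm 2, pow_mul]
    field_simp
    ring

lemma tendsto_pow_pow_two (hq0 : 0 < q) (hq1 : q < 1) :
    Tendsto (fun n : ℕ => q ^ 2 ^ n) atTop (𝓝 0) :=
  (tendsto_pow_atTop_nhds_zero_of_lt_one hq0.le hq1).comp
    (tendsto_pow_atTop_atTop_of_one_lt one_lt_two)

lemma pow_pow_two_le (hq0 : 0 < q) (hq1 : q < 1) (n : ℕ) : q ^ 2 ^ n ≤ q :=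
  pow_le_of_le_one hq0.le hq1.le (by positivity)

lemma tendsto_square (hq0 : 0 < q) (hq1 : q < 1) :
    Tendsto (fun n : ℕ => square (q ^ 2 ^ n)) atTop (𝓝 1) := by
  have h0 : ∑' k : ℤ, (if k = 0 then (1 : ℝ) else 0) = 1 := tsum_ite_eq 0 _
  rw [← h0]
  refine tendsto_tsum_of_dominated_convergence
    (summable_square (z := q) (by rwa [abs_of_pos hq0])) (fun k => ?_)
    (Eventually.of_forall fun n k => ?_)
  · rcases eq_or_ne k 0 with rfl | hk
    · simp
    · rw [if_neg hk]
      have h1 : k.natAbs ^ 2 ≠ 0 := pow_ne_zero 2 (Int.natAbs_ne_zero.2 hk)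
      have h2 := (tendsto_pow_pow_two hq0 hq1).pow (k.natAbs ^ 2)
      rwa [zero_pow h1] at h2
  · rw [Real.norm_of_nonneg (by positivity)]
    exact pow_le_pow_left₀ (by positivity) (pow_pow_two_le hq0 hq1 n) _

lemma tendsto_sechSum (hq0 : 0 < q) (hq1 : q < 1) :
    Tendsto (fun n : ℕ => sechSum (q ^ 2 ^ n)) atTop (𝓝 (1 / 2)) := by
  have h0 : ∑' k : ℤ, (if k = 0 then (1 / 2 : ℝ) else 0) = 1 / 2 := tsum_ite_eq 0 _
  rw [← h0]
  refine tendsto_tsum_of_dominated_convergence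
    (summable_pow_natAbs (z := q) (by rwa [abs_of_pos hq0])) (fun k => ?_)
    (Eventually.of_forall fun n k => ?_)
  · simp only [plusCoeff_mul_zpow_eq (pow_pos hq0 _)]
    rcases eq_or_ne k 0 with rfl | hk
    · norm_num
    · rw [if_neg hk]
      have h1 : k.natAbs ≠ 0 := Int.natAbs_ne_zero.2 hk
      have h2 := tendsto_pow_pow_two hq0 hq1
      have h3 := (h2.pow k.natAbs).div ((h2.pow (2 * k.natAbs)).const_add 1) (by simp [h1])
      simp only [zero_pow h1, zero_div] at h3
      exact h3
  · rw [plusCoeff_mul_zpow_eq (pow_pos hq0 _), Real.norm_of_nonneg (by positivity)]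
    refine (div_le_self (by positivity) (le_add_of_nonneg_right (by positivity))).trans ?_
    exact pow_le_pow_left₀ (by positivity) (pow_pow_two_le hq0 hq1 n) _

/-- **Jacobi's two-square theorem**. -/
lemma square_sq (hq0 : 0 < q) (hq1 : q < 1) : square q ^ 2 = 2 * sechSum q := by
  -- The ratio is constant along q^(2^n) → 0, where its limit is 1/2.
  have hconst : ∀ n : ℕ, sechSum (q ^ 2 ^ n) / square (q ^ 2 ^ n) ^ 2 =
      sechSum q / square q ^ 2 := by
    intro n
    induction n with
    | zero => simp
    | succ n ih =>
      rw [pow_succ 2 n, pow_mul, sechSum_sq_mul (pow_pos hq0 _)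
        ((pow_pow_two_le hq0 hq1 n).trans_lt hq1), ih]
  have h1 := (tendsto_sechSum hq0 hq1).div ((tendsto_square hq0 hq1).pow 2) (by norm_num)
  have h2 : sechSum q / square q ^ 2 = 1 / 2 / 1 ^ 2 :=
    tendsto_nhds_unique (tendsto_const_nhds.congr fun n => (hconst n).symm) h1
  have h3 := one_le_square hq0.le hq1
  rw [div_eq_iff (by positivity)] at h2
  linarith

/-! ### The four-square theorem -/

lemma hasSum_plusSqConst {p : ℝ} (hp0 : 0 < p) (hp : p < 1) :
    HasSum (fun k : ℕ => p ^ (k + 1) / (1 + p ^ (k + 1)) ^ 2) ((plusSqConst p - 1 / 4) / 2) := by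
  have hp' : |p| < 1 := by rwa [abs_of_pos hp0]
  have hs : Summable fun k : ℤ => plusCoeff p k * plusCoeff p (-k) := by
    simpa using summable_plus_conv_plus hp0.ne' hp' 0
  have hval : ∀ k : ℕ, plusCoeff p ((k : ℤ) + 1) * plusCoeff p (-((k : ℤ) + 1)) =
      p ^ (k + 1) / (1 + p ^ (k + 1)) ^ 2 := by
    intro k
    have h := isBilateral_plus hp0.ne' hp' k
    have h1 : 1 + p ^ (k + 1) ≠ 0 := by positivity
    rw [h.1, h.2]
    field_simp
    ring
  have h1 : Summable fun k : ℕ => p ^ (k + 1) / (1 + p ^ (k + 1)) ^ 2 := by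
    have := hs.comp_injective (i := fun n : ℕ => (n : ℤ) + 1) fun x y h => by simpa using h
    exact this.congr hval
  have h2 := HasSum.of_add_one_of_neg_add_one
    (f := fun k : ℤ => plusCoeff p k * plusCoeff p (-k)) (by simpa only [hval] using h1.hasSum)
    (by simpa only [neg_neg, mul_comm (plusCoeff p (-_)), hval] using h1.hasSum)
  have h3 : plusSqConst p = _ := h2.tsum_eq
  have h4 : plusCoeff p 0 = 1 / 2 := by norm_num [plusCoeff]
  rw [neg_zero, h4] at h3
  rw [h3]
  convert h1.hasSum using 1
  ring

lemma summable_lambert {p : ℝ} (hp : |p| < 1) :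
    Summable fun x : ℕ × ℕ => ((x.2 : ℝ) + 1) * (-1) ^ x.2 * p ^ ((x.1 + 1) * (x.2 + 1)) := by
  have h := (summable_prod_mul_pow (𝕜 := ℝ) 1 (r := p) hp).norm
  have h2 := (Equiv.prodCongr Equiv.pnatEquivNat Equiv.pnatEquivNat).symm.summable_iff.2 h
  refine Summable.of_norm (h2.congr fun x => ?_)
  simp [abs_of_nonneg (show (0 : ℝ) ≤ x.2 + 1 by positivity)]

/-- Sum a double series both ways; the inner sum over j of (j+1)(-1)^j x^(j+1) is x / (1 + x)². -/
lemma hasSum_lambert {p : ℝ} (hp0 : 0 < p) (hp : p < 1) :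
    HasSum (fun k : ℕ => ((k : ℝ) + 1) * (-1) ^ k * (p ^ (k + 1) / (1 - p ^ (k + 1))))
      ((plusSqConst p - 1 / 4) / 2) := by
  have hp' : |p| < 1 := by rwa [abs_of_pos hp0]
  have hs := (summable_lambert hp').hasSum
  have hlt : ∀ k : ℕ, p ^ (k + 1) < 1 := fun k => pow_lt_one₀ hp0.le hp (Nat.succ_ne_zero k)
  have h1 := hs.prod_fiberwise (g := fun k : ℕ => p ^ (k + 1) / (1 + p ^ (k + 1)) ^ 2) (fun i => by
    have h := hasSum_coe_mul_geometric_of_norm_lt_one (𝕜 := ℝ) (r := -p ^ (i + 1)) (by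
      rw [norm_neg, Real.norm_of_nonneg (by positivity)]; exact hlt i)
    have h2 := ((hasSum_nat_add_iff' 1).2 h).neg
    have h3 : p ^ (i + 1) / (1 + p ^ (i + 1)) ^ 2 = -(-p ^ (i + 1) / (1 - -p ^ (i + 1)) ^ 2 -
        ∑ j ∈ Finset.range 1, (j : ℝ) * (-p ^ (i + 1)) ^ j) := by
      simp
      ring
    rw [h3]
    refine h2.congr_fun fun j => ?_
    rw [neg_pow (p ^ (i + 1)), ← pow_mul, pow_succ (-1 : ℝ)]
    push_cast
    ring)
  have h2 := ((Equiv.prodComm ℕ ℕ).hasSum_iff.2 hs).prod_fiberwise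
    (g := fun k : ℕ => ((k : ℝ) + 1) * (-1) ^ k * (p ^ (k + 1) / (1 - p ^ (k + 1)))) (fun j => by
    have h := ((hasSum_geometric_of_lt_one (pow_nonneg hp0.le (j + 1)) (hlt j)).mul_left
      (p ^ (j + 1))).mul_left (((j : ℝ) + 1) * (-1) ^ j)
    rw [← div_eq_mul_inv] at h
    refine h.congr_fun fun i => ?_
    simp only [Function.comp, Equiv.prodComm_apply, Prod.swap]
    rw [mul_comm (i + 1), pow_mul, pow_succ (p ^ (j + 1)) i]
    ring)
  rwa [← h1.unique (hasSum_plusSqConst hp0 hp)]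

lemma hasSum_mul_minus {q : ℝ} (hq0 : 0 < q) (hq1 : q < 1) :
    HasSum (fun k : ℕ => ((k : ℝ) + 1) * (q ^ (k + 1) / (1 - q ^ (2 * (k + 1)))))
      ((∑' k : ℤ, (k : ℝ) * minusCoeff (q ^ 2) k * q ^ k) / 2) := by
  have hz : |q| < 1 := by rwa [abs_of_pos hq0]
  have hz2 := square_lt_abs hq0.ne' hz
  have hs : Summable fun k : ℤ => (k : ℝ) * minusCoeff (q ^ 2) k * q ^ k := by
    simpa using summable_minus (pow_ne_zero 2 hq0.ne') hz hz2 1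
  have hlt : ∀ k : ℕ, q ^ (2 * (k + 1)) < 1 := fun k => pow_lt_one₀ hq0.le hq1 (by positivity)
  have hB := isBilateral_minus (pow_ne_zero 2 hq0.ne') (hz2.trans hz)
  have hpos : ∀ k : ℕ, (((k : ℤ) + 1 : ℤ) : ℝ) * minusCoeff (q ^ 2) ((k : ℤ) + 1) *
      q ^ ((k : ℤ) + 1) = ((k : ℝ) + 1) * (q ^ (k + 1) / (1 - q ^ (2 * (k + 1)))) := by
    intro k
    have h5 : q ^ ((k : ℤ) + 1) = q ^ (k + 1) := by norm_cast
    have h6 : 1 - q ^ (2 * (k + 1)) ≠ 0 := by linarith [hlt k]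
    rw [(hB k).1, h5]
    simp only [← pow_mul]
    push_cast
    field_simp
    ring
  have hneg : ∀ k : ℕ, ((-((k : ℤ) + 1) : ℤ) : ℝ) * minusCoeff (q ^ 2) (-((k : ℤ) + 1)) *
      q ^ (-((k : ℤ) + 1)) = ((k : ℝ) + 1) * (q ^ (k + 1) / (1 - q ^ (2 * (k + 1)))) := by
    intro k
    have h5 : q ^ ((k : ℤ) + 1) = q ^ (k + 1) := by norm_cast
    have h6 : 1 - q ^ (2 * (k + 1)) ≠ 0 := by linarith [hlt k]
    rw [(hB k).2, zpow_neg, h5]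
    simp only [← pow_mul]
    push_cast
    field_simp
    ring
  have h1 : Summable fun k : ℕ => ((k : ℝ) + 1) * (q ^ (k + 1) / (1 - q ^ (2 * (k + 1)))) := by
    have := hs.comp_injective (i := fun n : ℕ => (n : ℤ) + 1) fun x y h => by simpa using h
    exact this.congr hpos
  have h2 := HasSum.of_add_one_of_neg_add_one
    (f := fun k : ℤ => (k : ℝ) * minusCoeff (q ^ 2) k * q ^ k)
    (by simpa only [hpos] using h1.hasSum) (by simpa only [hneg] using h1.hasSum)
  rw [h2.tsum_eq]
  convert h1.hasSum using 1
  simp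

/-- Square the two-square theorem: `sechSum q` is F(q) for p = q², and the coefficients of F² are
known. -/
lemma square_pow_four_eq (hq0 : 0 < q) (hq1 : q < 1) : square q ^ 4 =
    4 * (∑' k : ℤ, (k : ℝ) * minusCoeff (q ^ 2) k * q ^ k + plusSqConst (q ^ 2)) := by
  have hz : |q| < 1 := by rwa [abs_of_pos hq0]
  have hz2 := square_lt_abs hq0.ne' hz
  have hp0 := pow_ne_zero 2 hq0.ne'
  have h := hasSum_conv (b := plusCoeff (q ^ 2)) (c := plusCoeff (q ^ 2)) hq0.ne' 0
    (fun i _ => summable_plus hp0 hz hz2 i) (fun i _ => summable_plus hp0 hz hz2 i)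
  simp only [tsum_plus_conv_plus hp0 (hz2.trans hz), pow_zero, one_mul,
    Finset.Nat.antidiagonal_zero, Finset.sum_singleton, Nat.choose_zero_right, Nat.cast_one] at h
  have hs : Summable fun k : ℤ => (k : ℝ) * minusCoeff (q ^ 2) k * q ^ k := by
    simpa using summable_minus hp0 hz hz2 1
  have h2 := hasSum_single (f := fun k : ℤ =>
    (if k = 0 then plusSqConst (q ^ 2) else 0) * q ^ k) 0 (fun k hk => by simp [hk])
  have h3 := (hs.hasSum.add h2).unique (h.congr_fun fun k => by rw [plusSqCoeff]; ring)
  simp only [if_true, zpow_zero, mul_one] at h3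
  rw [h3, show square q ^ 4 = (square q ^ 2) ^ 2 by ring, square_sq hq0 hq1, sechSum]
  ring

/-- **Jacobi's four-square theorem**. -/
lemma four_squares (hq0 : 0 ≤ q) (hq1 : q < 1) :
    altMean 1 - 2 * powSum (fun k => (-q) ^ k / (1 + (-q) ^ k)) 1 (-1) = -(square q ^ 4 / 4) := by
  rcases hq0.eq_or_lt with rfl | hq0
  · have h : square 0 = 1 := by
      rw [square, tsum_eq_single 0 (fun k hk => by simp [hk])]
      simp
    simp [powSum, altMean_one, h]
    norm_num
  have hp0 : 0 < q ^ 2 := by positivity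
  have hp1 : q ^ 2 < 1 := pow_lt_one₀ hq0.le hq1 two_ne_zero
  have h1 := hasSum_mul_minus hq0 hq1
  have h2 := hasSum_lambert hp0 hp1
  have h3 := (h1.add h2).tsum_eq
  have h4 : powSum (fun k => (-q) ^ k / (1 + (-q) ^ k)) 1 (-1) =
      ∑' k : ℕ, (((k : ℝ) + 1) * (q ^ (k + 1) / (1 - q ^ (2 * (k + 1)))) +
        ((k : ℝ) + 1) * (-1) ^ k * ((q ^ 2) ^ (k + 1) / (1 - (q ^ 2) ^ (k + 1)))) := by
    refine tsum_congr fun k => ?_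
    have hx : q ^ (k + 1) < 1 := pow_lt_one₀ hq0.le hq1 (Nat.succ_ne_zero k)
    have hx0 : 0 < q ^ (k + 1) := by positivity
    have e1 : q ^ (2 * (k + 1)) = (q ^ (k + 1)) ^ 2 := by rw [← pow_mul, mul_comm]
    have e2 : (q ^ 2) ^ (k + 1) = (q ^ (k + 1)) ^ 2 := by rw [← pow_mul, ← pow_mul, mul_comm]
    simp only [e1, e2, neg_pow q, pow_one]
    set x := q ^ (k + 1)
    have h5 : 1 - x ^ 2 ≠ 0 := by nlinarith
    have h6 : 1 - x ≠ 0 := by linarith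
    have h7 : 1 + x ≠ 0 := by linarith
    rw [show 1 - x ^ 2 = (1 - x) * (1 + x) by ring]
    -- For even k the claim is (x + x²)/(1 - x²) = x/(1 - x), for odd k it is (x - x²)/(1 - x²) =
    -- x/(1 + x).
    rcases Nat.even_or_odd k with hk | hk
    · rw [pow_succ, hk.neg_one_pow]
      simp only [one_mul, neg_mul, ← sub_eq_add_neg]
      field_simp
    · rw [pow_succ, hk.neg_one_pow]
      simp only [neg_mul, one_mul, neg_neg, mul_neg]
      field_simp
      ring
  rw [h4, h3, square_pow_four_eq hq0 hq1, altMean_one]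
  ring

end

/-! ### Identification of ν₀ and ν₁, and their norms -/

section

variable {p : ℝ}

/-- Abel means of the values of a polynomial, given those of the monomials. -/
lemma hasAbelMean_polynomial {w : ℕ → ℝ} {L : ℝ[X] →ₗ[ℝ] ℝ}
    (h : ∀ n, HasAbelMean (fun k => w k * ((k : ℝ) ^ 2) ^ n) (L (X ^ n))) (f : ℝ[X]) :
    HasAbelMean (fun k => w k * f.eval ((k : ℝ) ^ 2)) (L f) := by
  induction f using Polynomial.induction_on' with
  | add f g hf hg =>
    rw [map_add]
    exact (hf.add hg).congr fun k => by rw [eval_add]; ring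
  | monomial n a =>
    rw [← smul_X_eq_monomial, map_smul, smul_eq_mul]
    refine ((h n).const_mul a).congr fun k => ?_
    rw [eval_smul, eval_pow, eval_X, smul_eq_mul]
    ring

/-- The functional `f ↦ (f(D²) v)'(0)` on polynomials. -/
noncomputable def seriesFunctional (v : PowerSeries ℝ) : ℝ[X] →ₗ[ℝ] ℝ :=
  derivAtZero ∘ₗ LinearMap.applyₗ v ∘ₗ (aeval secondDeriv).toLinearMap

lemma seriesFunctional_apply (v : PowerSeries ℝ) (f : ℝ[X]) :
    seriesFunctional v f = derivAtZero (aeval secondDeriv f v) := rfl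

variable {q A : ℝ} {Y : PowerSeries ℝ}

lemma hasAbelMean_nuZeroTerm (hq0 : 0 ≤ q) (hq1 : q < 1) (hY : IsMomentSeries (-q) A Y)
    (f : ℝ[X]) : HasAbelMean (nuZeroTerm q f) (-seriesFunctional Y f) := by
  have hp : |(-q)| < 1 := by rwa [abs_neg, abs_of_nonneg hq0]
  have key : ∀ n, HasAbelMean (fun k => (1 - (-q) ^ k) / (1 + (-q) ^ k) * (-1) ^ (k + 1) * (k : ℝ) *
      ((k : ℝ) ^ 2) ^ n) ((-seriesFunctional Y) (X ^ n)) := by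
    intro n
    rw [LinearMap.neg_apply, seriesFunctional_apply, map_pow, aeval_X, hY.ell_zero]
    -- The weight is (1 - p^k)/(1 + p^k) = 1 - 2p^k/(1 + p^k), and the factor -1 accounts for
    -- (-1)^(k+1).
    have h := ((geomBound_plus hp).hasAbelMean (2 * n + 1)).const_mul (-1)
    rw [neg_one_mul] at h
    refine h.congr fun k => ?_
    have h1 := abs_le.1 (abs_pow_succ_le hp k)
    have h2 : 1 + (-q) ^ (k + 1) ≠ 0 := by linarith [h1.1]
    rw [← pow_mul, pow_succ (-1 : ℝ) (k + 1), pow_succ _ (2 * n)]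
    field_simp
    ring
  have h := hasAbelMean_polynomial key f
  rw [LinearMap.neg_apply] at h
  exact h

lemma hasAbelMean_nuOneTerm (hq0 : 0 ≤ q) (hq1 : q < 1) (hY : IsMomentSeries (-q) A Y)
    (f : ℝ[X]) :
    HasAbelMean (nuOneTerm q f) (seriesFunctional (PowerSeries.derivative ℝ (Y ^ 2)) f) := by
  have hp : |(-q)| < 1 := by rwa [abs_neg, abs_of_nonneg hq0]
  refine hasAbelMean_polynomial (L := seriesFunctional (PowerSeries.derivative ℝ (Y ^ 2)))
    (w := fun k => (1 + (-q) ^ k) / (1 - (-q) ^ k) * (-1) ^ k * (k : ℝ) ^ 3) (fun n => ?_) f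
  rw [seriesFunctional_apply, map_pow, aeval_X, hY.ell_one]
  -- Here (1 + p^k)/(1 - p^k) = 1 - 2σ with σ = -p^k/(1 - p^k).
  refine ((geomBound_minus hp).hasAbelMean (2 * n + 3)).congr fun k => ?_
  have h1 := abs_le.1 (abs_pow_succ_le hp k)
  have h2 : 1 - (-q) ^ (k + 1) ≠ 0 := by linarith [h1.2]
  rw [← pow_mul, pow_add _ (2 * n)]
  field_simp
  ring

lemma nuZero_eq (hq0 : 0 ≤ q) (hq1 : q < 1) (hY : IsMomentSeries (-q) A Y) :
    nuZero q = ⇑((-2 : ℝ) • seriesFunctional Y) := by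
  funext f
  rw [nuZero, (hasAbelMean_nuZeroTerm hq0 hq1 hY f).abelMean_eq, LinearMap.smul_apply, smul_eq_mul]
  ring

lemma nuOne_eq (hq0 : 0 ≤ q) (hq1 : q < 1) (hY : IsMomentSeries (-q) A Y) :
    nuOne q = ⇑((2 : ℝ) • seriesFunctional (PowerSeries.derivative ℝ (Y ^ 2))) := by
  funext f
  rw [nuOne, (hasAbelMean_nuOneTerm hq0 hq1 hY f).abelMean_eq, LinearMap.smul_apply, smul_eq_mul]

lemma coeff_one_eq (hq0 : 0 ≤ q) (hq1 : q < 1) (hY : IsMomentSeries (-q) A Y) :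
    PowerSeries.coeff 1 Y = -(square q ^ 4 / 4) := by
  have h := hY.coeff_odd 0
  simp only [Nat.mul_zero, zero_add, Nat.factorial_one, Nat.cast_one, one_mul] at h
  rw [h, four_squares hq0 hq1]

lemma nuZero_orthogonal (hq0 : 0 ≤ q) (hq1 : q < 1) (hY : IsMomentSeries (-q) A Y) :
    (∃! P, IsMonicOrthogonal (nuZero q) P) ∧ ∀ P, IsMonicOrthogonal (nuZero q) P → ∀ k,
      normSq (nuZero q) (P k) = ((2 * k + 1).factorial : ℝ) * ((2 * k).factorial : ℝ) /
        2 ^ (4 * k + 1) * square q ^ (8 * k + 4) := by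
  have hs := one_le_square hq0 hq1
  rw [nuZero_eq hq0 hq1 hY]
  refine existsUnique_isMonicOrthogonal (T := secondDeriv) (ℓ := (-2 : ℝ) • derivAtZero)
    (u := oddPower Y)
    (β := fun k => if k = 0 then A else ((2 * k + 1 : ℕ) : ℝ) ^ 2 * A)
    (γ := fun k => ((2 * k + 1 : ℕ) : ℝ) * (2 * k) * PowerSeries.coeff 1 Y ^ 2 *
      ((2 * k) * (2 * k - 1)))
    hY.secondDeriv_oddPower_zero (fun k => ?_) (fun f => ?_) (fun i k h => ?_) (fun k => ?_)
    (fun k => by positivity)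
  · rw [hY.secondDeriv_oddPower]
    congr 2
    push_cast
    ring
  · rw [LinearMap.smul_apply, LinearMap.smul_apply, seriesFunctional_apply, oddPower]
    simp
  · rw [LinearMap.smul_apply, hY.ell_oddPower_of_lt h, smul_zero]
  -- Matches -2(-□⁴/4)^(2k+1) with the power of 2 in the stated norm.
  · have h2 : (2 : ℝ) ^ (4 * k + 1) = 4 ^ (2 * k + 1) / 2 := by
      rw [show (4 : ℝ) = 2 ^ 2 by norm_num, ← pow_mul, show 2 * (2 * k + 1) = 4 * k + 1 + 1 by ring,
        pow_succ]
      ring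
    rw [LinearMap.smul_apply, hY.ell_oddPower_self, coeff_one_eq hq0 hq1 hY, h2,
      Odd.neg_pow ⟨k, rfl⟩, div_pow, ← pow_mul, show 4 * (2 * k + 1) = 8 * k + 4 by ring,
      smul_eq_mul]
    field_simp

lemma nuOne_orthogonal (hq0 : 0 ≤ q) (hq1 : q < 1) (hY : IsMomentSeries (-q) A Y) :
    (∃! P, IsMonicOrthogonal (nuOne q) P) ∧ ∀ P, IsMonicOrthogonal (nuOne q) P → ∀ k,
      normSq (nuOne q) (P k) = ((2 * k + 2).factorial : ℝ) * ((2 * k + 1).factorial : ℝ) /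
        2 ^ (4 * k + 3) * square q ^ (8 * k + 8) := by
  have hs := one_le_square hq0 hq1
  rw [nuOne_eq hq0 hq1 hY]
  refine existsUnique_isMonicOrthogonal (T := secondDeriv) (ℓ := (2 : ℝ) • derivAtZero)
    (u := evenPower Y)
    (β := fun k => if k = 0 then 4 * A else ((2 * k + 2 : ℕ) : ℝ) ^ 2 * A)
    (γ := fun k => ((2 * k + 2 : ℕ) : ℝ) * (2 * k + 1) * PowerSeries.coeff 1 Y ^ 2 *
      ((2 * k + 1) * (2 * k)))
    hY.secondDeriv_evenPower_zero (fun k => ?_) (fun f => ?_) (fun i k h => ?_) (fun k => ?_)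
    (fun k => by positivity)
  · rw [hY.secondDeriv_evenPower]
    congr 2
    push_cast
    ring
  · rw [LinearMap.smul_apply, LinearMap.smul_apply, seriesFunctional_apply, evenPower]
    simp
  · rw [LinearMap.smul_apply, hY.ell_evenPower_of_lt h, smul_zero]
  · have h2 : (2 : ℝ) ^ (4 * k + 3) = 4 ^ (2 * k + 2) / 2 := by
      rw [show (4 : ℝ) = 2 ^ 2 by norm_num, ← pow_mul, show 2 * (2 * k + 2) = 4 * k + 3 + 1 by ring,
        pow_succ]
      ring
    rw [LinearMap.smul_apply, hY.ell_evenPower_self, coeff_one_eq hq0 hq1 hY, h2,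
      Even.neg_pow ⟨k + 1, by ring⟩, div_pow, ← pow_mul, show 4 * (2 * k + 2) = 8 * k + 8 by ring,
      smul_eq_mul]
    field_simp

end

/-! ### Product formulas from the norms -/

lemma pow_eq_prod_norms_zero {s : ℝ} {h : ℕ → ℝ} (hh : ∀ k : ℕ, h k =
    ((2 * k + 1).factorial : ℝ) * ((2 * k).factorial : ℝ) / 2 ^ (4 * k + 1) * s ^ (8 * k + 4))
    (m : ℕ) : s ^ (4 * m ^ 2) = 2 ^ (m * (2 * m - 1)) /
      (∏ i ∈ Finset.Icc 1 (2 * m - 1), (i.factorial : ℝ)) * ∏ i ∈ Finset.range m, h i := by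
  induction m with
  | zero => simp
  | succ m ih =>
    -- The subtraction 2m - 1 is truncated, so m = 0 is treated separately.
    have h1 : (m + 1) * (2 * (m + 1) - 1) = m * (2 * m - 1) + (4 * m + 1) := by
      rcases m with _ | m
      · rfl
      · simp only [show 2 * (m + 1 + 1) - 1 = 2 * m + 3 by omega,
          show 2 * (m + 1) - 1 = 2 * m + 1 by omega]
        ring
    have h2 : ∏ i ∈ Finset.Icc 1 (2 * (m + 1) - 1), (i.factorial : ℝ) =
        (∏ i ∈ Finset.Icc 1 (2 * m - 1), (i.factorial : ℝ)) *
          (((2 * m).factorial : ℝ) * ((2 * m + 1).factorial : ℝ)) := by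
      rcases m with _ | m
      · simp
      · rw [show 2 * (m + 1 + 1) - 1 = 2 * m + 1 + 1 + 1 by omega,
          show 2 * (m + 1) - 1 = 2 * m + 1 by omega, Finset.prod_Icc_succ_top (by omega),
          Finset.prod_Icc_succ_top (by omega), show 2 * (m + 1) = 2 * m + 1 + 1 by ring, mul_assoc]
    have h3 : ∏ i ∈ Finset.Icc 1 (2 * m - 1), (i.factorial : ℝ) ≠ 0 :=
      Finset.prod_ne_zero_iff.2 fun i _ => by positivity
    rw [show 4 * (m + 1) ^ 2 = 4 * m ^ 2 + (8 * m + 4) by ring, pow_add, ih, h1, h2,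
      Finset.prod_range_succ, hh m, pow_add (2 : ℝ)]
    field_simp

lemma pow_eq_prod_norms_one {s : ℝ} {h : ℕ → ℝ} (hh : ∀ k : ℕ, h k =
    ((2 * k + 2).factorial : ℝ) * ((2 * k + 1).factorial : ℝ) / 2 ^ (4 * k + 3) * s ^ (8 * k + 8))
    (m : ℕ) : s ^ (4 * m * (m + 1)) = 2 ^ (m * (2 * m + 1)) /
      (∏ i ∈ Finset.Icc 1 (2 * m), (i.factorial : ℝ)) * ∏ i ∈ Finset.range m, h i := by
  induction m with
  | zero => simp
  | succ m ih =>
    have h2 : ∏ i ∈ Finset.Icc 1 (2 * (m + 1)), (i.factorial : ℝ) =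
        (∏ i ∈ Finset.Icc 1 (2 * m), (i.factorial : ℝ)) *
          (((2 * m + 1).factorial : ℝ) * ((2 * m + 2).factorial : ℝ)) := by
      rw [show 2 * (m + 1) = 2 * m + 1 + 1 by ring, Finset.prod_Icc_succ_top (by omega),
        Finset.prod_Icc_succ_top (by omega), mul_assoc]
    have h3 : ∏ i ∈ Finset.Icc 1 (2 * m), (i.factorial : ℝ) ≠ 0 :=
      Finset.prod_ne_zero_iff.2 fun i _ => by positivity
    rw [show 4 * (m + 1) * (m + 1 + 1) = 4 * m * (m + 1) + (8 * m + 8) by ring, pow_add, ih,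
      show (m + 1) * (2 * (m + 1) + 1) = m * (2 * m + 1) + (4 * m + 3) by ring, h2,
      Finset.prod_range_succ, hh m, pow_add (2 : ℝ)]
    field_simp

end SumsOfSquares

theorem corollary3p7 (q : ℝ) (hq0 : 0 ≤ q) (hq1 : q < 1) :
    -- the moment functionals are well defined on polynomials
    (∀ f : Polynomial ℝ, SumsOfSquares.AbelSummable (SumsOfSquares.nuZeroTerm q f) ∧
      SumsOfSquares.AbelSummable (SumsOfSquares.nuOneTerm q f)) ∧
    -- the monic orthogonal polynomials exist and are unique
    (∃! p, SumsOfSquares.IsMonicOrthogonal (SumsOfSquares.nuZero q) p) ∧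
    (∃! p, SumsOfSquares.IsMonicOrthogonal (SumsOfSquares.nuOne q) p) ∧
    -- the formulas for the functional with index 0
    (∀ p, SumsOfSquares.IsMonicOrthogonal (SumsOfSquares.nuZero q) p →
      (∀ m : ℕ, SumsOfSquares.square q ^ (4 * m ^ 2) =
        2 ^ (m * (2 * m - 1)) / (∏ i ∈ Finset.Icc 1 (2 * m - 1), (i.factorial : ℝ)) *
          ∏ i ∈ Finset.range m, SumsOfSquares.normSq (SumsOfSquares.nuZero q) (p i)) ∧
      (∀ k : ℕ, SumsOfSquares.normSq (SumsOfSquares.nuZero q) (p k) =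
        ((2 * k + 1).factorial : ℝ) * ((2 * k).factorial : ℝ) / 2 ^ (4 * k + 1) *
          SumsOfSquares.square q ^ (8 * k + 4))) ∧
    -- the formulas for the functional with index 1
    (∀ p, SumsOfSquares.IsMonicOrthogonal (SumsOfSquares.nuOne q) p →
      (∀ m : ℕ, SumsOfSquares.square q ^ (4 * m * (m + 1)) =
        2 ^ (m * (2 * m + 1)) / (∏ i ∈ Finset.Icc 1 (2 * m), (i.factorial : ℝ)) *
          ∏ i ∈ Finset.range m, SumsOfSquares.normSq (SumsOfSquares.nuOne q) (p i)) ∧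
      (∀ k : ℕ, SumsOfSquares.normSq (SumsOfSquares.nuOne q) (p k) =
        ((2 * k + 2).factorial : ℝ) * ((2 * k + 1).factorial : ℝ) / 2 ^ (4 * k + 3) *
          SumsOfSquares.square q ^ (8 * k + 8))) := by
  have hp : |(-q)| < 1 := by rwa [abs_neg, abs_of_nonneg hq0]
  obtain ⟨A, Y, hY⟩ := SumsOfSquares.exists_isMomentSeries hp
  have h0 := SumsOfSquares.nuZero_orthogonal hq0 hq1 hY
  have h1 := SumsOfSquares.nuOne_orthogonal hq0 hq1 hY
  exact ⟨fun f => ⟨(SumsOfSquares.hasAbelMean_nuZeroTerm hq0 hq1 hY f).abelSummable,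
      (SumsOfSquares.hasAbelMean_nuOneTerm hq0 hq1 hY f).abelSummable⟩, h0.1, h1.1,
    fun p hP => ⟨SumsOfSquares.pow_eq_prod_norms_zero (h0.2 p hP), h0.2 p hP⟩,
    fun p hP => ⟨SumsOfSquares.pow_eq_prod_norms_one (h1.2 p hP), h1.2 p hP⟩⟩
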